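/- **Theorem 1 (Gaussian limit for One Step Thresholding).** Fix $Q>0$. For integers $n,\mathcal C\ge 1$ and a set $\Lambda\subseteq\{1,\dots,\mathcal C\}$ of transmitted messages with $|\Lambda|=K$, let $s\in\{0,1\}^{\mathcal C}$ be the indicator vector of $\Lambda$, let $X\in\mathbb R^{n\times\mathcal C}$ be a random codebook with i.i.d. $N(0,Q)$ entries, let $z\sim N(0,I_n)$ be independent of $X$, and put $$y=Xs+z,\qquad G=X^{T}y\in\mathbb R^{\mathcal C},$$ so that $G_1,\dots,G_{\mathcal C}$ are the correlations computed by One Step Thresholding. (a) Consider a sequence of such problems with parameters $(K_r,n_r,\mathcal C_r)$ and transmitted sets $\Lambda_r$, with $Q$ fixed, such that, as $r\to\infty$, $$n_r\to\infty,\qquad \frac{K_r}{\mathcal C_r}\to\delta,\qquad \frac{K_r+1/Q}{n_r}\to\rho\in[0,\infty).$$ Let $i_r\in\{1,\dots,\mathcal C_r\}$ for every $r$. Then, in distribution as $r\to\infty$, $$\frac{G_{i_r}}{n_rQ}\longrightarrow\begin{cases}N(1,\rho)&\text{if } i_r\in\Lambda_r\text{ for all } r,\\ N(0,\rho)&\text{if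 } i_r\notin\Lambda_r\text{ for all } r,\end{cases}$$ where the second parameter is the variance and $N(m,0)$ is the point mass at $m$. (b) For a single problem with parameters $(K,n,\mathcal C)$, let $\Phi$ be the standard normal distribution function. If $i\notin\Lambda$, then the distribution function $F$ of $\dfrac{G_i}{nQ\sqrt{(K+1/Q)/n}}$ satisfies $$\sup_{x\in\mathbb R}|F(x)-\Phi(x)|\le\frac{8}{\pi\sqrt n}.$$ If $i\in\Lambda$, $K\ge 2$ and $n\ge 12$, then the distribution function $F$ of $\dfrac{G_i-nQ}{nQ\sqrt{(K+1+1/Q)/n}}$ satisfies $$\sup_{x\in\mathbb R}|F(x)-\Phi(x)|\le\frac{64}{\pi\sqrt n}.$$ -/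

import Mathlib

open MeasureTheory ProbabilityTheory Filter Topology
open scoped NNReal Matrix

/-- The activity pattern `s ∈ {0,1}^C` of a set `Λ` of transmitted messages. -/
def activity {C : ℕ} (Λ : Finset (Fin C)) : Fin C → ℝ :=
  fun j => if j ∈ Λ then 1 else 0

/-- The received vector `y = X s + z`. -/
def received {n C : ℕ} (Λ : Finset (Fin C)) (X : Matrix (Fin n) (Fin C) ℝ) (z : Fin n → ℝ) :
    Fin n → ℝ :=
  X *ᵥ activity Λ + z

/-- The correlations `g = X* y` computed by One Step Thresholding (for a real codebook the adjoint
is the transpose), for the received vector `y = X s + z`. -/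
def ostCorrelation {n C : ℕ} (Λ : Finset (Fin C)) (X : Matrix (Fin n) (Fin C) ℝ)
    (z : Fin n → ℝ) : Fin C → ℝ :=
  Xᵀ *ᵥ received Λ X z

/-- The random codebook `X` has i.i.d. `N(0,Q)` entries, the noise `z` is `N(0, I_n)` (that is, has
i.i.d. standard normal coordinates), and the codebook and the noise are independent. -/
structure IsGaussianModel {Ω : Type*} [MeasurableSpace Ω] (P : Measure Ω) (Q : ℝ≥0) {n C : ℕ}
    (X : Ω → Matrix (Fin n) (Fin C) ℝ) (z : Ω → Fin n → ℝ) : Prop where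
  codebook_law : ∀ i j, HasLaw (fun ω => X ω i j) (gaussianReal 0 Q) P
  noise_law : ∀ i, HasLaw (fun ω => z ω i) (gaussianReal 0 1) P
  indep : iIndepFun
    (Sum.elim (fun (p : Fin n × Fin C) (ω : Ω) => X ω p.1 p.2) (fun (i : Fin n) (ω : Ω) => z ω i)) P

/-!
Given the codeword `X_i`, the correlation `G_i` is Gaussian, with variance proportional to the
energy `‖X_i‖²`, and with mean `‖X_i‖²` or `0` according to whether `i` is transmitted. Normalized
to have mean one, the energy is `V = 1 + O(n^{-1/2})` in `L¹`, being an average of `n` independent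
squares.

For the limit theorem, the characteristic function of `G_i / (n Q)` is the expectation of `e^{w V}`
with `Re w ≤ 0`, and `|E e^{w V} - e^w| ≤ |w| E|V - 1|`.

For the explicit bounds, freezing the conditional variance at its mean costs `O(E|V - 1|)` in the
distribution function. If `i` is not transmitted, what remains is exactly Gaussian. Otherwise it is
an independent Gaussian plus a centred chi-square sum, whose summands are replaced by Gaussian ones
following Lindeberg; the Gaussian part supplies the smoothing, so that third moments give the rate
`n^{-1/2}` without any Berry-Esseen theorem.
-/

/-! ### The Gaussian distribution function -/

lemma map_const_add_sqrt_mul_gaussianReal (m : ℝ) (v : ℝ≥0) :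
    (gaussianReal 0 1).map (fun y => m + √v * y) = gaussianReal m v := by
  change (gaussianReal 0 1).map ((m + ·) ∘ (√(v : ℝ) * ·)) = _
  rw [← Measure.map_map (by fun_prop) (by fun_prop), gaussianReal_map_const_mul,
    gaussianReal_map_const_add]
  congr 1
  · simp
  · ext
    simp

lemma cdf_gaussianReal (m : ℝ) {v : ℝ≥0} (hv : v ≠ 0) (x : ℝ) :
    cdf (gaussianReal m v) x = cdf (gaussianReal 0 1) ((x - m) / √v) := by
  have hs : 0 < √(v : ℝ) := Real.sqrt_pos.2 (NNReal.coe_pos.2 (pos_iff_ne_zero.2 hv))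
  rw [cdf_eq_real, cdf_eq_real, ← map_const_add_sqrt_mul_gaussianReal m v,
    map_measureReal_apply (by fun_prop) measurableSet_Iic]
  congr 1
  ext y
  simp only [Set.mem_preimage, Set.mem_Iic]
  rw [le_div_iff₀ hs, le_sub_iff_add_le', mul_comm y]

lemma cdf_gaussianReal_add (m : ℝ) (v : ℝ≥0) (x w : ℝ) :
    cdf (gaussianReal (m + w) v) x = cdf (gaussianReal m v) (x - w) := by
  rw [← gaussianReal_map_add_const, cdf_eq_real, cdf_eq_real,
    map_measureReal_apply (by fun_prop) measurableSet_Iic]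
  congr 1
  ext y
  simp [le_sub_iff_add_le]

lemma hasDerivAt_gaussianPDFReal (m : ℝ) (v : ℝ≥0) (x : ℝ) :
    HasDerivAt (gaussianPDFReal m v) (-((x - m) / v) * gaussianPDFReal m v x) x := by
  have h : HasDerivAt (fun y : ℝ => -(y - m) ^ 2 / (2 * v)) (-((x - m) / v)) x :=
    ((((hasDerivAt_id x).sub_const m).pow 2).neg.div_const (2 * (v : ℝ))).congr_deriv (by
      simp only [id_eq]; ring)
  refine (h.exp.const_mul _).congr_deriv ?_
  rw [gaussianPDFReal]
  ring

lemma hasDerivAt_cdf_gaussianReal (m : ℝ) {v : ℝ≥0} (hv : v ≠ 0) (x : ℝ) :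
    HasDerivAt (cdf (gaussianReal m v)) (gaussianPDFReal m v x) x := by
  have hint := integrable_gaussianPDFReal m v
  have hcont : Continuous (gaussianPDFReal m v) :=
    continuous_iff_continuousAt.2 fun y => (hasDerivAt_gaussianPDFReal m v y).continuousAt
  have hIic (y : ℝ) : cdf (gaussianReal m v) y = ∫ t in Set.Iic y, gaussianPDFReal m v t := by
    rw [cdf_eq_real, Measure.real, gaussianReal_apply_eq_integral _ hv, ENNReal.toReal_ofReal]
    exact integral_nonneg (gaussianPDFReal_nonneg m v)
  have hcdf : (cdf (gaussianReal m v) : ℝ → ℝ) = fun y =>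
      cdf (gaussianReal m v) 0 + ∫ t in (0 : ℝ)..y, gaussianPDFReal m v t := by
    ext y
    rw [hIic, hIic, ← intervalIntegral.integral_Iic_sub_Iic hint.integrableOn hint.integrableOn]
    ring
  rw [hcdf]
  exact (intervalIntegral.integral_hasDerivAt_right hint.intervalIntegrable
    hcont.stronglyMeasurable.stronglyMeasurableAtFilter hcont.continuousAt).const_add _

lemma mul_gaussianPDFReal_le (m : ℝ) (v : ℝ≥0) {x c : ℝ}
    (hc : c ≤ Real.exp ((x - m) ^ 2 / (2 * v))) :
    c * gaussianPDFReal m v x ≤ 1 / (2 * √v) := by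
  have hsqrt : 2 ≤ √(2 * Real.pi) := Real.le_sqrt_of_sq_le (by nlinarith [Real.pi_gt_three])
  have hexp : c * Real.exp (-(x - m) ^ 2 / (2 * v)) ≤ 1 := by
    rw [neg_div, Real.exp_neg, ← div_eq_mul_inv]
    exact div_le_one_of_le₀ hc (Real.exp_pos _).le
  calc c * gaussianPDFReal m v x
      = (√(2 * Real.pi))⁻¹ * (√v)⁻¹ * (c * Real.exp (-(x - m) ^ 2 / (2 * v))) := by
        rw [gaussianPDFReal, Real.sqrt_mul (by positivity), mul_inv]
        ring
    _ ≤ (√(2 * Real.pi))⁻¹ * (√v)⁻¹ * 1 := by gcongr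
    _ ≤ 2⁻¹ * (√v)⁻¹ * 1 := by gcongr
    _ = 1 / (2 * √v) := by rw [mul_one, one_div, mul_inv]

lemma abs_le_exp_sq_div_two (x : ℝ) : |x| ≤ Real.exp (x ^ 2 / 2) := by
  have := Real.add_one_le_exp (x ^ 2 / 2)
  nlinarith [sq_abs x, sq_nonneg (|x| - 1)]

lemma abs_sq_sub_one_le_exp_sq_div_two (x : ℝ) : |x ^ 2 - 1| ≤ Real.exp (x ^ 2 / 2) := by
  have := Real.quadratic_le_exp_of_nonneg (x := x ^ 2 / 2) (by positivity)
  rw [abs_le]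
  constructor <;> nlinarith [sq_nonneg x, sq_nonneg (x ^ 2 - 2)]

lemma abs_cdf_sub_cdf_le_one (μ ν : Measure ℝ) (x y : ℝ) : |cdf μ x - cdf ν y| ≤ 1 := by
  rw [abs_le]
  constructor <;> linarith [cdf_nonneg μ x, cdf_le_one μ x, cdf_nonneg ν y, cdf_le_one ν y]

lemma hasDerivAt_div_sqrt (y : ℝ) {s : ℝ} (hs : 0 < s) :
    HasDerivAt (fun s => y / √s) (-(y / √s) / (2 * s)) s := by
  refine ((hasDerivAt_const s y).fun_div (Real.hasDerivAt_sqrt hs.ne')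
    (Real.sqrt_pos.2 hs).ne').congr_deriv ?_
  field_simp
  rw [Real.sq_sqrt hs.le]
  ring

lemma abs_cdf_gaussianReal_mul_sub_le (m : ℝ) {v : ℝ≥0} (hv : v ≠ 0) (t : ℝ≥0) (x : ℝ) :
    |cdf (gaussianReal m (v * t)) x - cdf (gaussianReal m v) x| ≤ 3 / 2 * |(t : ℝ) - 1| := by
  rcases lt_or_ge (t : ℝ) (1 / 3) with ht | ht
  · refine (abs_cdf_sub_cdf_le_one _ _ _ _).trans ?_
    rw [abs_of_neg (by linarith)]
    linarith
  set y := (x - m) / √(v : ℝ) with hy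
  have hderiv (s : ℝ) (hs : 1 / 3 ≤ s) : HasDerivAt (fun s => cdf (gaussianReal 0 1) (y / √s))
      (gaussianPDFReal 0 1 (y / √s) * (-(y / √s) / (2 * s))) s :=
    (hasDerivAt_cdf_gaussianReal 0 one_ne_zero _).comp s (hasDerivAt_div_sqrt y (by linarith))
  have hbound (s : ℝ) (hs : 1 / 3 ≤ s) :
      ‖gaussianPDFReal 0 1 (y / √s) * (-(y / √s) / (2 * s))‖ ≤ 3 / 4 := by
    have := mul_gaussianPDFReal_le 0 1 (x := y / √s) (c := |y / √s|) (by
      simpa using abs_le_exp_sq_div_two (y / √s))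
    rw [NNReal.coe_one, Real.sqrt_one, mul_one] at this
    rw [norm_mul, norm_div, norm_neg, Real.norm_of_nonneg (gaussianPDFReal_nonneg _ _ _),
      Real.norm_of_nonneg (show 0 ≤ 2 * s by linarith), Real.norm_eq_abs, mul_div_assoc', mul_comm]
    calc |y / √s| * gaussianPDFReal 0 1 (y / √s) / (2 * s) ≤ 1 / 2 / (2 * (1 / 3)) := by gcongr
      _ = 3 / 4 := by norm_num
  have := (convex_Ici (1 / 3 : ℝ)).norm_image_sub_le_of_norm_hasDerivWithin_le
    (fun s hs => (hderiv s hs).hasDerivWithinAt) hbound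
    (show (1 : ℝ) ∈ Set.Ici (1 / 3) by norm_num [Set.mem_Ici]) (show (t : ℝ) ∈ _ from ht)
  have ht0 : t ≠ 0 := by
    rintro rfl
    norm_num at ht
  rw [cdf_gaussianReal m (mul_ne_zero hv ht0), cdf_gaussianReal m hv, NNReal.coe_mul,
    Real.sqrt_mul v.coe_nonneg, ← div_div, ← hy]
  rw [Real.sqrt_one, div_one, Real.norm_eq_abs, Real.norm_eq_abs] at this
  linarith [abs_nonneg ((t : ℝ) - 1)]

lemma abs_image_add_sub_le {f f' : ℝ → ℝ} {C u h : ℝ} (hf : ∀ x, HasDerivAt f (f' x) x)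
    (hC : ∀ k, |k| ≤ |h| → |f' (u + k)| ≤ C) : |f (u + h) - f u| ≤ C * |h| := by
  have := (convex_closedBall u |h|).norm_image_sub_le_of_norm_hasDerivWithin_le (y := u + h)
    (fun x _ => (hf x).hasDerivWithinAt)
    (fun x hx => by simpa using hC (x - u) (by simpa [Real.dist_eq] using hx))
    (Metric.mem_closedBall_self (abs_nonneg h)) (by simp)
  simpa using this

lemma abs_sub_taylor_two_le {f f₁ f₂ f₃ : ℝ → ℝ} {M : ℝ} (h₀ : ∀ x, HasDerivAt f (f₁ x) x)
    (h₁ : ∀ x, HasDerivAt f₁ (f₂ x) x) (h₂ : ∀ x, HasDerivAt f₂ (f₃ x) x)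
    (hM : ∀ x, |f₃ x| ≤ M) (u h : ℝ) :
    |f (u + h) - (f u + f₁ u * h + f₂ u / 2 * h ^ 2)| ≤ M * |h| ^ 3 := by
  have hM0 : 0 ≤ M := (abs_nonneg _).trans (hM 0)
  have e₂ (k : ℝ) : |f₂ (u + k) - f₂ u| ≤ M * |k| := abs_image_add_sub_le h₂ fun l _ => hM _
  have e₁ (k : ℝ) : |f₁ (u + k) - (f₁ u + f₂ u * k)| ≤ M * |k| ^ 2 := by
    have hderiv (x : ℝ) : HasDerivAt (fun x => f₁ x - f₂ u * (x - u)) (f₂ x - f₂ u) x :=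
      ((h₁ x).sub (((hasDerivAt_id x).sub_const u).const_mul (f₂ u))).congr_deriv (by simp)
    convert abs_image_add_sub_le (u := u) (h := k) (C := M * |k|) hderiv
      (fun l hl => (e₂ l).trans (by gcongr)) using 1
    · simp; ring_nf
    · ring
  have hderiv (x : ℝ) : HasDerivAt (fun x => f x - f₁ u * (x - u) - f₂ u / 2 * (x - u) ^ 2)
      (f₁ x - (f₁ u + f₂ u * (x - u))) x := by
    have hid := (hasDerivAt_id x).sub_const u
    refine (((h₀ x).sub (hid.const_mul (f₁ u))).sub
      ((hid.pow 2).const_mul (f₂ u / 2))).congr_deriv ?_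
    simp; ring
  convert abs_image_add_sub_le (u := u) (h := h) (C := M * |h| ^ 2) hderiv
    (fun k hk => by
      rw [add_sub_cancel_left]
      exact (e₁ k).trans (by gcongr)) using 1
  · simp; ring_nf
  · ring

lemma abs_cdf_gaussianReal_sub_taylor_le (m : ℝ) {v : ℝ≥0} (hv : v ≠ 0) (u h : ℝ) :
    |cdf (gaussianReal m v) (u + h) - (cdf (gaussianReal m v) u + gaussianPDFReal m v u * h
        + -((u - m) / v) * gaussianPDFReal m v u / 2 * h ^ 2)|
      ≤ 1 / (2 * √v ^ 3) * |h| ^ 3 := by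
  have hv0 : 0 < (v : ℝ) := NNReal.coe_pos.2 (pos_iff_ne_zero.2 hv)
  have h₂ (x : ℝ) : HasDerivAt (fun x => -((x - m) / v) * gaussianPDFReal m v x)
      ((((x - m) / √v) ^ 2 - 1) / v * gaussianPDFReal m v x) x := by
    refine ((((hasDerivAt_id x).sub_const m).div_const (v : ℝ)).neg.mul
      (hasDerivAt_gaussianPDFReal m v x)).congr_deriv ?_
    simp only [id_eq, Pi.neg_apply]
    rw [div_pow, Real.sq_sqrt hv0.le]
    field_simp
    ring
  refine abs_sub_taylor_two_le (hasDerivAt_cdf_gaussianReal m hv) (hasDerivAt_gaussianPDFReal m v)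
    h₂ (fun x => ?_) u h
  have hpdf := mul_gaussianPDFReal_le m v (x := x) (by
    convert abs_sq_sub_one_le_exp_sq_div_two ((x - m) / √v) using 2
    rw [div_pow, Real.sq_sqrt hv0.le, div_div, mul_comm])
  rw [abs_mul, abs_div, abs_of_pos hv0, abs_of_nonneg (gaussianPDFReal_nonneg m v x),
    div_mul_eq_mul_div]
  calc _ ≤ 1 / (2 * √v) / v := by gcongr
    _ = 1 / (2 * √v ^ 3) := by
      rw [pow_succ, Real.sq_sqrt hv0.le, div_div]; ring

/-! ### Moments -/

lemma integrable_pow_gaussianReal (m : ℝ) (v : ℝ≥0) (k : ℕ) :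
    Integrable (fun x : ℝ => x ^ k) (gaussianReal m v) := by
  rcases Nat.eq_zero_or_pos k with rfl | hk
  · simp
  · refine (integrable_norm_iff (by fun_prop)).1 ?_
    simpa using (memLp_id_gaussianReal (μ := m) (v := v) (k : ℝ≥0)).integrable_norm_pow hk.ne'

lemma integral_pow_add_two_gaussianReal (v : ℝ≥0) (k : ℕ) :
    ∫ x, x ^ (k + 2) ∂gaussianReal 0 v = (k + 1) * v * ∫ x, x ^ k ∂gaussianReal 0 v := by
  rcases eq_or_ne v 0 with rfl | hv
  · simp
  have hint (j : ℕ) : Integrable (fun x : ℝ => gaussianPDFReal 0 v x * x ^ j) := by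
    have h := integrable_pow_gaussianReal 0 v j
    rw [gaussianReal_of_var_ne_zero _ hv, integrable_withDensity_iff (measurable_gaussianPDF 0 v)
      (ae_of_all _ fun _ => gaussianPDF_lt_top)] at h
    simpa [mul_comm] using h
  have hderiv (x : ℝ) : HasDerivAt (fun x => v * (gaussianPDFReal 0 v x * x ^ (k + 1)))
      ((k + 1) * v * (gaussianPDFReal 0 v x * x ^ k) - gaussianPDFReal 0 v x * x ^ (k + 2)) x := by
    refine (((hasDerivAt_gaussianPDFReal 0 v x).mul
      (hasDerivAt_pow (k + 1) x)).const_mul (v : ℝ)).congr_deriv ?_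
    have : (v : ℝ) ≠ 0 := NNReal.coe_ne_zero.2 hv
    push_cast
    field_simp
    ring
  have h := integral_eq_zero_of_hasDerivAt_of_integrable hderiv
    (((hint k).const_mul _).sub (hint (k + 2))) ((hint (k + 1)).const_mul _)
  rw [integral_sub ((hint k).const_mul _) (hint (k + 2)), integral_const_mul] at h
  simp only [integral_gaussianReal_eq_integral_smul hv, smul_eq_mul]
  linarith

lemma integral_sq_gaussianReal (v : ℝ≥0) : ∫ x, x ^ 2 ∂gaussianReal 0 v = v := by
  simpa using integral_pow_add_two_gaussianReal v 0

lemma integral_pow_four_gaussianReal (v : ℝ≥0) :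
    ∫ x, x ^ 4 ∂gaussianReal 0 v = 3 * (v : ℝ) ^ 2 := by
  rw [integral_pow_add_two_gaussianReal v 2, integral_sq_gaussianReal]
  push_cast
  ring

lemma integral_pow_six_gaussianReal (v : ℝ≥0) :
    ∫ x, x ^ 6 ∂gaussianReal 0 v = 15 * (v : ℝ) ^ 3 := by
  rw [integral_pow_add_two_gaussianReal v 4, integral_pow_four_gaussianReal]
  push_cast
  ring

lemma integral_sq_sub_one_gaussianReal : ∫ x, (x ^ 2 - 1) ∂gaussianReal 0 1 = 0 := by
  rw [integral_sub (integrable_pow_gaussianReal 0 1 2) (integrable_const _),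
    integral_sq_gaussianReal]
  simp

lemma integral_sq_sub_one_sq_gaussianReal : ∫ x, (x ^ 2 - 1) ^ 2 ∂gaussianReal 0 1 = 2 := by
  have h4 := integrable_pow_gaussianReal 0 1 4
  have h2 := (integrable_pow_gaussianReal 0 1 2).const_mul 2
  calc ∫ x, (x ^ 2 - 1) ^ 2 ∂gaussianReal 0 1
      = ∫ x, (x ^ 4 - 2 * x ^ 2 + 1) ∂gaussianReal 0 1 := by congr 1; ext; ring
    _ = 2 := by
      rw [integral_add (by exact h4.sub h2) (integrable_const _), integral_sub h4 h2,
        integral_const_mul, integral_pow_four_gaussianReal, integral_sq_gaussianReal]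
      norm_num

lemma memLp_three_sq_sub_one_gaussianReal (m : ℝ) (v : ℝ≥0) :
    MemLp (fun x : ℝ => x ^ 2 - 1) 3 (gaussianReal m v) := by
  refine MemLp.sub ?_ (memLp_const 1)
  have h := (memLp_id_gaussianReal (μ := m) (v := v) 6).norm_rpow_div 2
  rw [show ((6 : ℝ≥0) : ENNReal) = 3 * 2 by norm_num,
    ENNReal.mul_div_cancel_right two_ne_zero ENNReal.ofNat_ne_top] at h
  simpa using h

lemma integral_abs_sq_sub_one_pow_three_gaussianReal_le :
    ∫ x, |x ^ 2 - 1| ^ 3 ∂gaussianReal 0 1 ≤ 16 := by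
  have hle (x : ℝ) : |x ^ 2 - 1| ^ 3 ≤ x ^ 6 + 1 := by
    rcases le_total (x ^ 2) 1 with h | h
    · have : |x ^ 2 - 1| ^ 3 ≤ 1 :=
        pow_le_one₀ (abs_nonneg _) (abs_le.2 ⟨by nlinarith, by linarith⟩)
      have h6 : 0 ≤ x ^ 6 := by positivity
      linarith
    · have : |x ^ 2 - 1| ^ 3 ≤ (x ^ 2) ^ 3 := by
        rw [abs_of_nonneg (by linarith)]
        gcongr
        linarith
      linarith [pow_mul x 2 3]
  have h6 := (integrable_pow_gaussianReal 0 1 6).add (integrable_const 1)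
  calc ∫ x, |x ^ 2 - 1| ^ 3 ∂gaussianReal 0 1 ≤ ∫ x, (x ^ 6 + 1) ∂gaussianReal 0 1 :=
        integral_mono_of_nonneg (ae_of_all _ fun x => by positivity) h6 (ae_of_all _ hle)
    _ = 16 := by
      rw [integral_add (integrable_pow_gaussianReal 0 1 6) (integrable_const _),
        integral_pow_six_gaussianReal]
      norm_num

lemma integral_abs_pow_three_gaussianReal_le (v : ℝ≥0) :
    ∫ x, |x| ^ 3 ∂gaussianReal 0 v ≤ 2 * √v ^ 3 := by
  rcases eq_or_ne v 0 with rfl | hv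
  · simp
  have : 0 < √(v : ℝ) := Real.sqrt_pos.2 (NNReal.coe_pos.2 (pos_iff_ne_zero.2 hv))
  -- `|x|³ ≤ (s x² + x⁴ / s) / 2` with `s = √v`, by the arithmetic-geometric mean inequality.
  have hle (x : ℝ) : |x| ^ 3 ≤ √v / 2 * x ^ 2 + 1 / (2 * √v) * x ^ 4 := by
    have hsq : 0 ≤ 1 / (2 * √v) * (|x| * (√v - |x|)) ^ 2 := by positivity
    have hexpand : 1 / (2 * √v) * (|x| * (√v - |x|)) ^ 2
        = √v / 2 * |x| ^ 2 + 1 / (2 * √v) * (|x| ^ 2) ^ 2 - |x| ^ 3 := by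
      field_simp
      ring
    rw [hexpand, sq_abs, ← pow_mul] at hsq
    linarith
  have h2 := (integrable_pow_gaussianReal 0 v 2).const_mul (√v / 2)
  have h4 := (integrable_pow_gaussianReal 0 v 4).const_mul (1 / (2 * √v))
  calc ∫ x, |x| ^ 3 ∂gaussianReal 0 v
      ≤ ∫ x, (√v / 2 * x ^ 2 + 1 / (2 * √v) * x ^ 4) ∂gaussianReal 0 v :=
        integral_mono_of_nonneg (ae_of_all _ fun x => by positivity) (h2.add h4) (ae_of_all _ hle)
    _ = √v / 2 * √v ^ 2 + 1 / (2 * √v) * (3 * (√v ^ 2) ^ 2) := by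
      rw [integral_add h2 h4, integral_const_mul, integral_const_mul, integral_sq_gaussianReal,
        integral_pow_four_gaussianReal, Real.sq_sqrt v.coe_nonneg]
    _ = 2 * √v ^ 3 := by
      field_simp
      ring

/-! ### Convolutions and Lindeberg replacement -/

lemma integral_map_prod {α β E : Type*} [MeasurableSpace α] [MeasurableSpace β]
    [NormedAddCommGroup E] [NormedSpace ℝ E] {μ : Measure α} {ν : Measure β} [SFinite μ] [SFinite ν]
    {F : α × β → ℝ} (hF : AEMeasurable F (μ.prod ν)) {f : ℝ → E} (hfm : StronglyMeasurable f)
    (hf : Integrable f ((μ.prod ν).map F)) :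
    ∫ y, f y ∂(μ.prod ν).map F = ∫ a, ∫ y, f y ∂ν.map (fun b => F (a, b)) ∂μ := by
  rw [integral_map hF hfm.aestronglyMeasurable, integral_prod (fun p => f (F p))
    (hf.comp_aemeasurable hF)]
  refine integral_congr_ae ?_
  filter_upwards [hF.aestronglyMeasurable.prodMk_left] with a ha
  exact (integral_map ha.aemeasurable hfm.aestronglyMeasurable).symm

lemma cdf_eq_integral (μ : Measure ℝ) [IsProbabilityMeasure μ] (x : ℝ) :
    cdf μ x = ∫ y, (Set.Iic x).indicator (fun _ => (1 : ℝ)) y ∂μ := by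
  rw [integral_indicator_const _ measurableSet_Iic, cdf_eq_real]
  simp

lemma cdf_map_prod {α β : Type*} [MeasurableSpace α] [MeasurableSpace β] {μ : Measure α}
    {ν : Measure β} [IsProbabilityMeasure μ] [IsProbabilityMeasure ν] {F : α × β → ℝ}
    (hF : AEMeasurable F (μ.prod ν)) (x : ℝ) :
    cdf ((μ.prod ν).map F) x = ∫ a, cdf (ν.map fun b => F (a, b)) x ∂μ := by
  have := Measure.isProbabilityMeasure_map hF
  rw [cdf_eq_integral, integral_map_prod hF (stronglyMeasurable_const.indicator measurableSet_Iic)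
    ((integrable_const 1).indicator measurableSet_Iic)]
  refine integral_congr_ae ?_
  filter_upwards [hF.aestronglyMeasurable.prodMk_left] with a ha
  have := Measure.isProbabilityMeasure_map ha.aemeasurable
  exact (cdf_eq_integral _ x).symm

lemma integrable_cdf_comp {Ω : Type*} [MeasurableSpace Ω] {P : Measure Ω} [IsFiniteMeasure P]
    (μ : Measure ℝ) {Y : Ω → ℝ} (hY : AEMeasurable Y P) : Integrable (fun ω => cdf μ (Y ω)) P :=
  Integrable.of_bound ((monotone_cdf μ).measurable.comp_aemeasurable hY).aestronglyMeasurable 1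
    (ae_of_all _ fun ω => by
      rw [Real.norm_of_nonneg (cdf_nonneg _ _)]
      exact cdf_le_one _ _)

lemma cdf_conv (μ ν : Measure ℝ) [IsProbabilityMeasure μ] [IsProbabilityMeasure ν] (x : ℝ) :
    cdf (μ ∗ ν) x = ∫ w, cdf μ (x - w) ∂ν := by
  rw [Measure.conv_comm, Measure.conv, cdf_map_prod (by fun_prop)]
  congr 1
  ext w
  have := Measure.isProbabilityMeasure_map (μ := μ) (measurable_const_add w).aemeasurable
  rw [cdf_eq_real, cdf_eq_real, map_measureReal_apply (by fun_prop) measurableSet_Iic,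
    Set.preimage_const_add_Iic]

lemma abs_cdf_conv_sub_cdf_conv_le {μ μ' : Measure ℝ} (ν : Measure ℝ) [IsProbabilityMeasure μ]
    [IsProbabilityMeasure μ'] [IsProbabilityMeasure ν] {c : ℝ} (h : ∀ y, |cdf μ y - cdf μ' y| ≤ c)
    (x : ℝ) : |cdf (μ ∗ ν) x - cdf (μ' ∗ ν) x| ≤ c := by
  rw [cdf_conv, cdf_conv, ← integral_sub (integrable_cdf_comp _ (by fun_prop))
    (integrable_cdf_comp _ (by fun_prop)), ← Real.norm_eq_abs]
  refine (norm_integral_le_of_norm_le_const (C := c) (ae_of_all _ fun w => h (x - w))).trans_eq ?_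
  simp

lemma abs_integral_sub_le_of_abs_sub_quadratic_le {ν : Measure ℝ} [IsProbabilityMeasure ν]
    (hν : MemLp id 3 ν) {f : ℝ → ℝ} {A B C M : ℝ} (hfm : AEStronglyMeasurable f ν)
    (hf : ∀ w, |f w - (A + B * w + C * w ^ 2)| ≤ M * |w| ^ 3) :
    |∫ w, f w ∂ν - (A + B * ∫ w, w ∂ν + C * ∫ w, w ^ 2 ∂ν)| ≤ M * ∫ w, |w| ^ 3 ∂ν := by
  have h1 : Integrable (fun w => w) ν := hν.integrable (by norm_num)
  have h2 : Integrable (fun w => w ^ 2) ν := (hν.mono_exponent (by norm_num)).integrable_sq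
  have h3 : Integrable (fun w => |w| ^ 3) ν := hν.integrable_norm_pow (by norm_num)
  have hAB : Integrable (fun w => A + B * w) ν := (integrable_const A).add (h1.const_mul B)
  have hp : Integrable (fun w => A + B * w + C * w ^ 2) ν := hAB.add (h2.const_mul C)
  have hr : Integrable (fun w => f w - (A + B * w + C * w ^ 2)) ν :=
    (h3.const_mul M).mono' (hfm.sub hp.aestronglyMeasurable) (ae_of_all _ fun w => hf w)
  have hfi : Integrable f ν := (hr.add hp).congr (ae_of_all _ fun w => sub_add_cancel _ _)
  have hpoly : ∫ w, (A + B * w + C * w ^ 2) ∂ν = A + B * ∫ w, w ∂ν + C * ∫ w, w ^ 2 ∂ν := by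
    rw [integral_add hAB (h2.const_mul C), integral_add (integrable_const A) (h1.const_mul B),
      integral_const_mul, integral_const_mul]
    simp
  rw [← hpoly, ← integral_sub hfi hp, ← integral_const_mul, ← Real.norm_eq_abs]
  exact norm_integral_le_of_norm_le (h3.const_mul M) (ae_of_all _ fun w => hf w)

lemma abs_cdf_gaussianReal_conv_sub_le (m : ℝ) {v τ : ℝ≥0} (hv : v ≠ 0) {ν : Measure ℝ}
    [IsProbabilityMeasure ν] (hν : MemLp id 3 ν) (hν1 : ∫ w, w ∂ν = 0) (hν2 : ∫ w, w ^ 2 ∂ν = τ)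
    (u : ℝ) :
    |cdf (gaussianReal m v ∗ ν) u - cdf (gaussianReal m (v + τ)) u|
      ≤ 1 / (2 * √v ^ 3) * (∫ w, |w| ^ 3 ∂ν + 2 * √τ ^ 3) := by
  have htaylor (κ : Measure ℝ) [IsProbabilityMeasure κ] (hκ : MemLp id 3 κ) :=
    abs_integral_sub_le_of_abs_sub_quadratic_le hκ
      (f := fun w => cdf (gaussianReal m v) (u - w)) (A := cdf (gaussianReal m v) u)
      (B := -gaussianPDFReal m v u) (C := -((u - m) / v) * gaussianPDFReal m v u / 2)
      (integrable_cdf_comp _ (by fun_prop)).aestronglyMeasurable fun w => by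
        convert abs_cdf_gaussianReal_sub_taylor_le m hv u (-w) using 2
        · rw [← sub_eq_add_neg]
          ring
        · rw [abs_neg]
  have hgauss : MemLp id 3 (gaussianReal 0 τ) := memLp_id_gaussianReal 3
  have h₁ := abs_le.1 (htaylor ν hν)
  have h₂ := abs_le.1 (htaylor _ hgauss)
  have h₃ : 1 / (2 * √(v : ℝ) ^ 3) * ∫ w, |w| ^ 3 ∂gaussianReal 0 τ
      ≤ 1 / (2 * √v ^ 3) * (2 * √τ ^ 3) := by
    gcongr
    exact integral_abs_pow_three_gaussianReal_le τ
  rw [hν1, hν2] at h₁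
  rw [integral_id_gaussianReal, integral_sq_gaussianReal] at h₂
  rw [← add_zero m, ← gaussianReal_conv_gaussianReal, add_zero, cdf_conv, cdf_conv, mul_add,
    abs_le]
  constructor <;> linarith

lemma abs_cdf_gaussianReal_conv_sum_sub_le {Ω ι : Type*} [MeasurableSpace Ω] {P : Measure Ω}
    {ξ : ι → Ω → ℝ} (hξ : iIndepFun ξ P) (hξ3 : ∀ i, MemLp (ξ i) 3 P)
    (hξ1 : ∀ i, ∫ ω, ξ i ω ∂P = 0) {τ : ι → ℝ≥0} (hξ2 : ∀ i, ∫ ω, ξ i ω ^ 2 ∂P = τ i)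
    (m : ℝ) {v : ℝ≥0} (hv : v ≠ 0) (s : Finset ι) (u : ℝ) :
    |cdf (gaussianReal m v ∗ P.map (∑ i ∈ s, ξ i)) u - cdf (gaussianReal m (v + ∑ i ∈ s, τ i)) u|
      ≤ 1 / (2 * √v ^ 3) * ∑ i ∈ s, (∫ ω, |ξ i ω| ^ 3 ∂P + 2 * √(τ i) ^ 3) := by
  classical
  have := hξ.isProbabilityMeasure
  induction s using Finset.induction generalizing u with
  | empty => simp [Pi.zero_def, Measure.map_const, Measure.conv_dirac_zero]
  | insert j s hj ih =>
    have hm (i : ι) : AEMeasurable (ξ i) P := (hξ3 i).aestronglyMeasurable.aemeasurable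
    have hms : AEMeasurable (∑ i ∈ s, ξ i) P := Finset.aemeasurable_sum _ fun i _ => hm i
    have := Measure.isProbabilityMeasure_map (hm j)
    have := Measure.isProbabilityMeasure_map hms
    have hlaw : P.map (∑ i ∈ insert j s, ξ i) = P.map (∑ i ∈ s, ξ i) ∗ P.map (ξ j) := by
      rw [Finset.sum_insert hj, add_comm]
      exact (hξ.indepFun_finsetSum_of_notMem₀ hm hj).map_add_eq_map_conv_map₀ hms (hm j)
    have hreplace := abs_cdf_gaussianReal_conv_sub_le m (v := v + ∑ i ∈ s, τ i) (τ := τ j)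
      (by positivity) ((memLp_map_measure_iff aestronglyMeasurable_id (hm j)).2 (hξ3 j))
      (by rw [integral_map (hm j) (by fun_prop), hξ1])
      (by rw [integral_map (hm j) (by fun_prop), hξ2]) u
    rw [integral_map (hm j) (by fun_prop)] at hreplace
    have hmono : 1 / (2 * √(↑(v + ∑ i ∈ s, τ i) : ℝ) ^ 3)
        * (∫ ω, |ξ j ω| ^ 3 ∂P + 2 * √(τ j) ^ 3)
        ≤ 1 / (2 * √v ^ 3) * (∫ ω, |ξ j ω| ^ 3 ∂P + 2 * √(τ j) ^ 3) := by
      gcongr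
      exact le_self_add
    have hcontract := abs_cdf_conv_sub_cdf_conv_le (P.map (ξ j)) ih u
    rw [hlaw, ← Measure.conv_assoc, Finset.sum_insert hj, Finset.sum_insert hj, mul_add,
      add_comm (τ j), ← add_assoc]
    exact (abs_sub_le _ _ _).trans
      ((add_le_add hcontract (hreplace.trans hmono)).trans_eq (add_comm _ _))

/-! ### Gaussian mixtures -/

/-- The Gaussian mixture with random mean `m` and random variance `v`: the law of `m + √v Z`, where
`Z` is standard normal and independent of `(m, v)`. Each correlation has such a law, `m` and `v`
being functions of the codeword it tests. -/
noncomputable def gaussianMixture {Ω : Type*} [MeasurableSpace Ω] (P : Measure Ω) (m : Ω → ℝ)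
    (v : Ω → ℝ≥0) : Measure ℝ :=
  (P.prod (gaussianReal 0 1)).map fun p => m p.1 + √(v p.1) * p.2

section gaussianMixture

variable {Ω : Type*} [MeasurableSpace Ω] {P : Measure Ω} {m : Ω → ℝ} {v : Ω → ℝ≥0}

lemma aemeasurable_add_sqrt_mul [SFinite P] (hm : AEMeasurable m P) (hv : AEMeasurable v P) :
    AEMeasurable (fun p : Ω × ℝ => m p.1 + √(v p.1) * p.2) (P.prod (gaussianReal 0 1)) :=
  hm.comp_fst.add (hv.comp_fst.coe_nnreal_real.sqrt.mul measurable_snd.aemeasurable)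

lemma isProbabilityMeasure_gaussianMixture [IsProbabilityMeasure P] (hm : AEMeasurable m P)
    (hv : AEMeasurable v P) : IsProbabilityMeasure (gaussianMixture P m v) :=
  Measure.isProbabilityMeasure_map (aemeasurable_add_sqrt_mul hm hv)

lemma cdf_gaussianMixture [IsProbabilityMeasure P] (hm : AEMeasurable m P)
    (hv : AEMeasurable v P) (x : ℝ) :
    cdf (gaussianMixture P m v) x = ∫ ω, cdf (gaussianReal (m ω) (v ω)) x ∂P := by
  rw [gaussianMixture, cdf_map_prod (aemeasurable_add_sqrt_mul hm hv)]
  simp only [map_const_add_sqrt_mul_gaussianReal]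

lemma charFun_gaussianMixture [IsProbabilityMeasure P] (hm : AEMeasurable m P)
    (hv : AEMeasurable v P) (t : ℝ) :
    charFun (gaussianMixture P m v) t = ∫ ω, charFun (gaussianReal (m ω) (v ω)) t ∂P := by
  have := isProbabilityMeasure_gaussianMixture hm hv
  have hint : Integrable (fun y : ℝ => Complex.exp (t * y * Complex.I)) (gaussianMixture P m v) :=
    Integrable.of_bound (by fun_prop) 1 (ae_of_all _ fun y => by
      rw [← Complex.ofReal_mul, Complex.norm_exp_ofReal_mul_I])
  simp only [charFun_apply_real]
  rw [gaussianMixture, integral_map_prod (aemeasurable_add_sqrt_mul hm hv) (by fun_prop) hint]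
  simp only [map_const_add_sqrt_mul_gaussianReal]

lemma map_prod_eq_gaussianMixture {β : Type*} [MeasurableSpace β] {ν : Measure β}
    [IsProbabilityMeasure P] [IsProbabilityMeasure ν] {F : Ω × β → ℝ}
    (hF : AEMeasurable F (P.prod ν)) (hm : AEMeasurable m P) (hv : AEMeasurable v P)
    (h : ∀ ω, ν.map (fun b => F (ω, b)) = gaussianReal (m ω) (v ω)) :
    (P.prod ν).map F = gaussianMixture P m v := by
  have := Measure.isProbabilityMeasure_map hF
  have := isProbabilityMeasure_gaussianMixture hm hv
  refine Measure.eq_of_cdf _ _ (StieltjesFunction.ext fun x => ?_)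
  simp only [cdf_map_prod hF, cdf_gaussianMixture hm hv, h]

lemma integrable_cdf_gaussianReal [IsFiniteMeasure P] (hm : AEMeasurable m P)
    (hv : AEMeasurable v P) (x : ℝ) : Integrable (fun ω => cdf (gaussianReal (m ω) (v ω)) x) P := by
  refine Integrable.of_bound (C := 1) ?_ (ae_of_all _ fun ω => ?_)
  · simp only [cdf_eq_real, Measure.real]
    exact ((Measure.measurable_coe measurableSet_Iic).comp
      measurable_gaussianReal).comp_aemeasurable (hm.prodMk hv)
      |>.ennreal_toReal.aestronglyMeasurable
  · rw [Real.norm_of_nonneg (cdf_nonneg _ _)]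
    exact cdf_le_one _ _

lemma gaussianMixture_map {Ω' : Type*} [MeasurableSpace Ω'] {a : Ω' → Ω} {P : Measure Ω'}
    [IsProbabilityMeasure P] (ha : AEMeasurable a P) (hm : Measurable m) (hv : Measurable v) :
    gaussianMixture (P.map a) m v = gaussianMixture P (m ∘ a) (v ∘ a) := by
  have := Measure.isProbabilityMeasure_map ha
  have hma := hm.comp_aemeasurable ha
  have hva := hv.comp_aemeasurable ha
  have := isProbabilityMeasure_gaussianMixture hma hva
  have := isProbabilityMeasure_gaussianMixture (P := P.map a) hm.aemeasurable hv.aemeasurable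
  refine Measure.eq_of_cdf _ _ (StieltjesFunction.ext fun x => ?_)
  rw [cdf_gaussianMixture hm.aemeasurable hv.aemeasurable, cdf_gaussianMixture hma hva,
    integral_map ha (integrable_cdf_gaussianReal hm.aemeasurable hv.aemeasurable
      x).aestronglyMeasurable]
  rfl

lemma gaussianMixture_const [IsProbabilityMeasure P] (hm : AEMeasurable m P) (v : ℝ≥0) :
    gaussianMixture P m (fun _ => v) = gaussianReal 0 v ∗ P.map m := by
  have := Measure.isProbabilityMeasure_map hm
  have := isProbabilityMeasure_gaussianMixture hm (aemeasurable_const (b := v))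
  refine Measure.eq_of_cdf _ _ (StieltjesFunction.ext fun x => ?_)
  rw [cdf_gaussianMixture hm aemeasurable_const, cdf_conv,
    integral_map hm (integrable_cdf_comp _ (by fun_prop)).aestronglyMeasurable]
  simp only [← cdf_gaussianReal_add, zero_add]

lemma map_sub_div_gaussianMixture [IsProbabilityMeasure P] (hm : AEMeasurable m P)
    (hv : AEMeasurable v P) (b d : ℝ) :
    (gaussianMixture P m v).map (fun y => (y - b) / d)
      = gaussianMixture P (fun ω => (m ω - b) / d) (fun ω => v ω / ‖d‖₊ ^ 2) := by
  have hF := aemeasurable_add_sqrt_mul hm hv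
  rw [gaussianMixture, AEMeasurable.map_map_of_aemeasurable (by fun_prop) hF]
  refine map_prod_eq_gaussianMixture ((hF.sub_const b).div_const d) ((hm.sub_const b).div_const d)
    (hv.div_const _) fun ω => ?_
  have hcomp : (fun z => ((fun y => (y - b) / d) ∘ fun p : Ω × ℝ => m p.1 + √(v p.1) * p.2) (ω, z))
      = (· / d) ∘ (· - b) ∘ fun z => m ω + √(v ω) * z := rfl
  rw [hcomp, ← Measure.map_map (by fun_prop) (by fun_prop),
    ← Measure.map_map (by fun_prop) (by fun_prop), map_const_add_sqrt_mul_gaussianReal,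
    gaussianReal_map_sub_const, gaussianReal_map_div_const]
  congr 2
  ext
  simp

lemma abs_cdf_gaussianMixture_sub_le [IsProbabilityMeasure P] (hm : AEMeasurable m P)
    {V : Ω → ℝ≥0} (hV : Integrable (fun ω => (V ω : ℝ)) P) {τ : ℝ≥0} (hτ : τ ≠ 0) (x : ℝ) :
    |cdf (gaussianMixture P m fun ω => τ * V ω) x - cdf (gaussianMixture P m fun _ => τ) x|
      ≤ 3 / 2 * ∫ ω, |(V ω : ℝ) - 1| ∂P := by
  have hVm : AEMeasurable V P := aemeasurable_coe_nnreal_real_iff.1 hV.aemeasurable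
  rw [cdf_gaussianMixture hm (hVm.const_mul τ), cdf_gaussianMixture hm aemeasurable_const,
    ← integral_sub (integrable_cdf_gaussianReal hm (hVm.const_mul τ) x)
      (integrable_cdf_gaussianReal hm aemeasurable_const x), ← integral_const_mul,
    ← Real.norm_eq_abs]
  exact norm_integral_le_of_norm_le ((hV.sub (integrable_const 1)).abs.const_mul _)
    (ae_of_all _ fun ω => abs_cdf_gaussianReal_mul_sub_le (m ω) hτ (V ω) x)

lemma map_eq_gaussianMixture_of_indepFun [IsProbabilityMeasure P] {α β : Type*}
    [MeasurableSpace α] [MeasurableSpace β] {a : Ω → α} {w : Ω → β} (hind : IndepFun a w P)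
    (ha : AEMeasurable a P) (hw : AEMeasurable w P) {F : α × β → ℝ} (hF : Measurable F)
    {m : α → ℝ} {v : α → ℝ≥0} (hm : Measurable m) (hv : Measurable v)
    (h : ∀ c, P.map (fun ω => F (c, w ω)) = gaussianReal (m c) (v c)) :
    P.map (fun ω => F (a ω, w ω)) = gaussianMixture P (m ∘ a) (v ∘ a) := by
  have := Measure.isProbabilityMeasure_map ha
  have := Measure.isProbabilityMeasure_map hw
  have hjoint := (indepFun_iff_map_prod_eq_prod_map_map ha hw).1 hind
  rw [← gaussianMixture_map ha hm hv, ← map_prod_eq_gaussianMixture (ν := P.map w) hF.aemeasurable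
    hm.aemeasurable hv.aemeasurable fun c => ?_, ← hjoint,
    AEMeasurable.map_map_of_aemeasurable hF.aemeasurable (ha.prodMk hw)]
  · rfl
  · exact (AEMeasurable.map_map_of_aemeasurable
      (hF.comp measurable_prodMk_left).aemeasurable hw).trans (h c)

end gaussianMixture

lemma norm_exp_mul_sub_exp_le {w : ℂ} (hw : w.re ≤ 0) {s : ℝ} (hs : 0 ≤ s) :
    ‖Complex.exp (w * s) - Complex.exp w‖ ≤ ‖w‖ * |s - 1| := by
  have hderiv (r : ℝ) : HasDerivAt (fun r : ℝ => Complex.exp (w * r)) (Complex.exp (w * r) * w) r :=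
    by simpa using ((Complex.ofRealCLM.hasDerivAt (x := r)).const_mul w).cexp
  have hbound (r : ℝ) (hr : 0 ≤ r) : ‖Complex.exp (w * r) * w‖ ≤ ‖w‖ := by
    rw [norm_mul, Complex.norm_exp]
    refine mul_le_of_le_one_left (norm_nonneg _) (Real.exp_le_one_iff.2 ?_)
    simpa using mul_nonpos_of_nonpos_of_nonneg hw hr
  simpa using (convex_Ici (0 : ℝ)).norm_image_sub_le_of_norm_hasDerivWithin_le
    (fun r _ => (hderiv r).hasDerivWithinAt) hbound (Set.mem_Ici.2 zero_le_one) hs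

lemma norm_charFun_gaussianReal_mul_sub_le (m : ℝ) (v s : ℝ≥0) (t : ℝ) :
    ‖charFun (gaussianReal (m * s) (v * s)) t - charFun (gaussianReal m v) t‖
      ≤ (|t * m| + v * t ^ 2 / 2) * |(s : ℝ) - 1| := by
  set w : ℂ := ((t * m : ℝ) : ℂ) * Complex.I - ((v * t ^ 2 / 2 : ℝ) : ℂ) with hw
  have hre : w.re ≤ 0 := by
    have : 0 ≤ v * t ^ 2 / 2 := by positivity
    simpa [hw, -Complex.ofReal_mul, -Complex.ofReal_div] using this
  have hnorm : ‖w‖ ≤ |t * m| + v * t ^ 2 / 2 := by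
    refine (norm_sub_le _ _).trans_eq ?_
    rw [norm_mul, Complex.norm_I, mul_one, Complex.norm_real, Complex.norm_real, Real.norm_eq_abs,
      Real.norm_of_nonneg (by positivity)]
  rw [charFun_gaussianReal, charFun_gaussianReal]
  calc _ = ‖Complex.exp (w * (s : ℝ)) - Complex.exp w‖ := by
        congr 3 <;> (rw [hw]; push_cast; ring)
    _ ≤ ‖w‖ * |(s : ℝ) - 1| := norm_exp_mul_sub_exp_le hre s.coe_nonneg
    _ ≤ _ := by gcongr

lemma norm_charFun_gaussianMixture_sub_le {Ω : Type*} [MeasurableSpace Ω] {P : Measure Ω}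
    [IsProbabilityMeasure P] (m : ℝ) (v : ℝ≥0) {V : Ω → ℝ≥0}
    (hV : Integrable (fun ω => (V ω : ℝ)) P) (t : ℝ) :
    ‖charFun (gaussianMixture P (fun ω => m * V ω) fun ω => v * V ω) t
        - charFun (gaussianReal m v) t‖
      ≤ (|t * m| + v * t ^ 2 / 2) * ∫ ω, |(V ω : ℝ) - 1| ∂P := by
  have hVm : AEMeasurable V P := aemeasurable_coe_nnreal_real_iff.1 hV.aemeasurable
  have hconst : charFun (gaussianReal m v) t = ∫ _, charFun (gaussianReal m v) t ∂P := by simp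
  have hint : Integrable (fun ω => charFun (gaussianReal (m * V ω) (v * V ω)) t) P := by
    refine Integrable.of_bound (C := 1) ?_ (ae_of_all _ fun ω => norm_charFun_le_one t)
    simp only [charFun_gaussianReal]
    have := hVm.coe_nnreal_real
    fun_prop
  rw [charFun_gaussianMixture (hVm.coe_nnreal_real.const_mul m) (hVm.const_mul v), hconst,
    ← integral_sub hint (integrable_const _), ← integral_const_mul]
  exact norm_integral_le_of_norm_le ((hV.sub (integrable_const 1)).abs.const_mul _)
    (ae_of_all _ fun ω => norm_charFun_gaussianReal_mul_sub_le m v (V ω) t)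

lemma tendstoInDistribution_of_map_eq_gaussianMixture {Ω : ℕ → Type*}
    [∀ r, MeasurableSpace (Ω r)] {P : ∀ r, Measure (Ω r)} [∀ r, IsProbabilityMeasure (P r)]
    {Y : ∀ r, Ω r → ℝ} (hY : ∀ r, AEMeasurable (Y r) (P r)) {V : ∀ r, Ω r → ℝ≥0}
    (hV : ∀ r, Integrable (fun ω => (V r ω : ℝ)) (P r)) {m : ℝ} {v : ℕ → ℝ≥0} {ρ : ℝ≥0}
    (hlaw : ∀ᶠ r in atTop, (P r).map (Y r)
      = gaussianMixture (P r) (fun ω => m * V r ω) fun ω => v r * V r ω)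
    (hV1 : Tendsto (fun r => ∫ ω, |(V r ω : ℝ) - 1| ∂P r) atTop (𝓝 0))
    (hv : Tendsto (fun r => (v r : ℝ)) atTop (𝓝 ρ)) :
    TendstoInDistribution Y atTop id P (gaussianReal m ρ) := by
  refine ⟨hY, by fun_prop, ProbabilityMeasure.tendsto_of_tendsto_charFun fun t => ?_⟩
  simp only [ProbabilityMeasure.coe_mk, Measure.map_id]
  have hgauss : Tendsto (fun r => charFun (gaussianReal m (v r)) t) atTop
      (𝓝 (charFun (gaussianReal m ρ) t)) := by
    simp only [charFun_gaussianReal]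
    have : Tendsto (fun r => ((v r : ℝ) : ℂ)) atTop (𝓝 ((ρ : ℝ) : ℂ)) :=
      (Complex.continuous_ofReal.tendsto _).comp hv
    exact (Complex.continuous_exp.tendsto _).comp
      (tendsto_const_nhds.sub ((this.mul_const _).div_const _))
  have hbound : Tendsto (fun r => (|t * m| + v r * t ^ 2 / 2) * ∫ ω, |(V r ω : ℝ) - 1| ∂P r) atTop
      (𝓝 0) := by
    simpa using (((hv.mul_const (t ^ 2)).div_const 2).const_add |t * m|).mul hV1
  refine (tendsto_iff_of_dist ?_).1 hgauss
  refine squeeze_zero' (Eventually.of_forall fun r => dist_nonneg) ?_ hbound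
  filter_upwards [hlaw] with r hr
  rw [hr, dist_comm, dist_eq_norm]
  exact norm_charFun_gaussianMixture_sub_le m (v r) (hV r) t

/-! ### The energy of a Gaussian codeword -/

section IndependentSums

variable {Ω ι : Type*} [MeasurableSpace Ω] {P : Measure Ω}

lemma hasLaw_sum_mul_gaussianReal {Y : ι → Ω → ℝ} {q : ι → ℝ≥0} (hind : iIndepFun Y P)
    (hlaw : ∀ i, HasLaw (Y i) (gaussianReal 0 (q i)) P) (c : ι → ℝ) (s : Finset ι) :
    HasLaw (fun ω => ∑ i ∈ s, c i * Y i ω) (gaussianReal 0 (∑ i ∈ s, ‖c i‖₊ ^ 2 * q i)) P := by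
  classical
  have := hind.isProbabilityMeasure
  have hterm (i : ι) : HasLaw (fun ω => c i * Y i ω) (gaussianReal 0 (‖c i‖₊ ^ 2 * q i)) P := by
    convert! gaussianReal_const_mul (hlaw i) (c i) using 2
    · simp
    · ext
      simp
  refine ⟨Finset.aemeasurable_fun_sum _ fun i _ => (hterm i).aemeasurable, ?_⟩
  induction s using Finset.induction_on with
  | empty => simp
  | insert i s hi ih =>
    have hindep : IndepFun (fun ω => c i * Y i ω) (∑ j ∈ s, fun ω => c j * Y j ω) P :=
      ((hind.comp (fun j y => c j * y) (fun j => by fun_prop)).indepFun_finsetSum_of_notMem₀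
        (fun j => (hterm j).aemeasurable) hi).symm
    have hadd := gaussianReal_add_gaussianReal_of_indepFun hindep (hterm i).map_eq
      (by rw [← ih]; congr 1; ext ω; simp)
    rw [Finset.sum_insert hi, ← add_zero (0 : ℝ), ← hadd]
    congr 1
    ext ω
    simp [Finset.sum_insert hi]

lemma integral_abs_sum_le_sqrt [Fintype ι] {ξ : ι → Ω → ℝ} (hξ : iIndepFun ξ P)
    (hξ2 : ∀ i, MemLp (ξ i) 2 P) (hξ1 : ∀ i, ∫ ω, ξ i ω ∂P = 0) :
    ∫ ω, |∑ i, ξ i ω| ∂P ≤ √(∑ i, ∫ ω, ξ i ω ^ 2 ∂P) := by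
  have := hξ.isProbabilityMeasure
  have hsum : MemLp (∑ i, ξ i) 2 P := memLp_finsetSum' _ fun i _ => hξ2 i
  have hmean : P[∑ i, ξ i] = 0 := by
    simp only [Finset.sum_apply]
    rw [integral_finsetSum _ fun i _ => (hξ2 i).integrable one_le_two]
    simp only [hξ1, Finset.sum_const_zero]
  have hvar : ∫ ω, (∑ i, ξ i) ω ^ 2 ∂P = ∑ i, ∫ ω, ξ i ω ^ 2 ∂P := by
    rw [← variance_of_integral_eq_zero hsum.aemeasurable hmean,
      IndepFun.variance_sum (fun i _ => hξ2 i) fun i _ j _ hij => hξ.indepFun hij]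
    exact Finset.sum_congr rfl fun i _ =>
      variance_of_integral_eq_zero (hξ2 i).aemeasurable (hξ1 i)
  refine Real.le_sqrt_of_sq_le ?_
  have hnonneg := variance_nonneg |∑ i, ξ i| P
  rw [variance_eq_sub hsum.abs] at hnonneg
  simp only [Pi.pow_apply, Pi.abs_apply, sq_abs, hvar] at hnonneg
  simpa only [Finset.sum_apply] using sub_nonneg.1 hnonneg

lemma memLp_three_sq_sub_one {Y : Ω → ℝ} (hY : HasLaw Y (gaussianReal 0 1) P) :
    MemLp (fun ω => Y ω ^ 2 - 1) 3 P := by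
  have := memLp_three_sq_sub_one_gaussianReal 0 1
  rw [← hY.map_eq] at this
  exact this.comp_of_map hY.aemeasurable

lemma integral_sq_sub_one {Y : Ω → ℝ} (hY : HasLaw Y (gaussianReal 0 1) P) :
    ∫ ω, (Y ω ^ 2 - 1) ∂P = 0 :=
  (hY.integral_comp (f := fun y => y ^ 2 - 1) (by fun_prop)).trans
    integral_sq_sub_one_gaussianReal

lemma integral_sq_sub_one_sq {Y : Ω → ℝ} (hY : HasLaw Y (gaussianReal 0 1) P) :
    ∫ ω, (Y ω ^ 2 - 1) ^ 2 ∂P = 2 :=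
  (hY.integral_comp (f := fun y => (y ^ 2 - 1) ^ 2) (by fun_prop)).trans
    integral_sq_sub_one_sq_gaussianReal

lemma integral_abs_sq_sub_one_pow_three_le {Y : Ω → ℝ} (hY : HasLaw Y (gaussianReal 0 1) P) :
    ∫ ω, |Y ω ^ 2 - 1| ^ 3 ∂P ≤ 16 :=
  (hY.integral_comp (f := fun y => |y ^ 2 - 1| ^ 3) (by fun_prop)).trans_le
    integral_abs_sq_sub_one_pow_three_gaussianReal_le

lemma abs_cdf_gaussianReal_conv_sum_sq_sub_one_sub_le [Fintype ι] {Y : ι → Ω → ℝ}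
    (hY : iIndepFun Y P) (hlaw : ∀ i, HasLaw (Y i) (gaussianReal 0 1) P) (c : ℝ≥0) {v : ℝ≥0}
    (hv : v ≠ 0) (x : ℝ) :
    |cdf (gaussianReal 0 v ∗ P.map fun ω => c * ∑ i, (Y i ω ^ 2 - 1)) x
        - cdf (gaussianReal 0 (v + Fintype.card ι * (2 * c ^ 2))) x|
      ≤ 11 * Fintype.card ι * (c / √v) ^ 3 := by
  set ξ : ι → Ω → ℝ := fun i ω => c * (Y i ω ^ 2 - 1) with hξ
  have hind : iIndepFun ξ P := hY.comp (fun _ y => c * (y ^ 2 - 1)) fun _ => by fun_prop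
  have hmem (i : ι) : MemLp (ξ i) 3 P := (memLp_three_sq_sub_one (hlaw i)).const_mul _
  have hmean (i : ι) : ∫ ω, ξ i ω ∂P = 0 := by
    simp only [hξ, integral_const_mul, integral_sq_sub_one (hlaw i), mul_zero]
  have hsq (i : ι) : ∫ ω, ξ i ω ^ 2 ∂P = (2 * c ^ 2 : ℝ≥0) := by
    simp only [hξ, mul_pow, integral_const_mul, integral_sq_sub_one_sq (hlaw i)]
    push_cast
    ring
  have hcube (i : ι) : ∫ ω, |ξ i ω| ^ 3 ∂P ≤ c ^ 3 * 16 := by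
    simp only [hξ, abs_mul, mul_pow, integral_const_mul, NNReal.abs_eq]
    gcongr
    exact integral_abs_sq_sub_one_pow_three_le (hlaw i)
  have hsqrt : √((2 * c ^ 2 : ℝ≥0) : ℝ) ^ 3 ≤ 3 * c ^ 3 := by
    have hsqrt2 : √2 ^ 3 ≤ 3 := by
      nlinarith [Real.sq_sqrt (zero_le_two (α := ℝ)), Real.sqrt_nonneg 2]
    push_cast
    rw [Real.sqrt_mul zero_le_two, Real.sqrt_sq c.coe_nonneg, mul_pow]
    gcongr
  have hlindeberg := abs_cdf_gaussianReal_conv_sum_sub_le hind hmem hmean hsq 0 hv Finset.univ x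
  have hfun : ∑ i, ξ i = fun ω => (c : ℝ) * ∑ i, (Y i ω ^ 2 - 1) := by
    ext ω
    simp only [hξ, Finset.sum_apply, Finset.mul_sum]
  rw [hfun, Finset.sum_const, Finset.card_univ, nsmul_eq_mul] at hlindeberg
  calc _ ≤ _ := hlindeberg
    _ ≤ 1 / (2 * √v ^ 3) * ∑ _i : ι, (c ^ 3 * 16 + 2 * (3 * c ^ 3) : ℝ) := by
      gcongr with i
      exact hcube i
    _ = 11 * Fintype.card ι * (c / √v) ^ 3 := by
      rw [Finset.sum_const, Finset.card_univ, nsmul_eq_mul]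
      field_simp
      ring

end IndependentSums

/-- The squared norm of a vector divided by its expectation when the coordinates are independent
with law `N(0, Q)`. -/
noncomputable def normalizedEnergy {ι : Type*} [Fintype ι] (Q : ℝ≥0) (a : ι → ℝ) : ℝ≥0 :=
  (∑ m, ‖a m‖₊ ^ 2) / (Fintype.card ι * Q)

section normalizedEnergy

variable {ι : Type*} [Fintype ι] {Q : ℝ≥0}

lemma measurable_normalizedEnergy (Q : ℝ≥0) :
    Measurable (normalizedEnergy Q : (ι → ℝ) → ℝ≥0) := by
  unfold normalizedEnergy
  fun_prop

lemma mul_normalizedEnergy (hQ : Q ≠ 0) (a : ι → ℝ) :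
    (Fintype.card ι * Q) * normalizedEnergy Q a = ∑ m, ‖a m‖₊ ^ 2 := by
  rcases isEmpty_or_nonempty ι
  · simp
  · exact mul_div_cancel₀ _ (mul_ne_zero (Nat.cast_ne_zero.2 Fintype.card_ne_zero) hQ)

lemma normalizedEnergy_sub_one [Nonempty ι] (hQ : Q ≠ 0) (a : ι → ℝ) :
    (normalizedEnergy Q a : ℝ) - 1 = (∑ m, ((a m / √Q) ^ 2 - 1)) / Fintype.card ι := by
  have hQ' : (Q : ℝ) ≠ 0 := NNReal.coe_ne_zero.2 hQ
  simp only [div_pow, Real.sq_sqrt Q.coe_nonneg, Finset.sum_sub_distrib, ← Finset.sum_div,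
    normalizedEnergy, NNReal.coe_div, NNReal.coe_sum, NNReal.coe_pow, coe_nnnorm, Real.norm_eq_abs,
    sq_abs, NNReal.coe_mul, NNReal.coe_natCast, Finset.sum_const, Finset.card_univ, nsmul_eq_mul]
  field_simp

lemma hasLaw_div_sqrt {Ω : Type*} [MeasurableSpace Ω] {P : Measure Ω} {Y : Ω → ℝ} (hQ : Q ≠ 0)
    (hY : HasLaw Y (gaussianReal 0 Q) P) : HasLaw (fun ω => Y ω / √Q) (gaussianReal 0 1) P := by
  convert! gaussianReal_div_const hY √Q using 2
  · simp
  · ext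
    simp [hQ]

variable {Ω : Type*} [MeasurableSpace Ω] {P : Measure Ω} {a : Ω → ι → ℝ}

lemma integrable_normalizedEnergy (ha : ∀ m, HasLaw (fun ω => a ω m) (gaussianReal 0 Q) P) :
    Integrable (fun ω => (normalizedEnergy Q (a ω) : ℝ)) P := by
  have hsq (m : ι) : Integrable (fun ω => a ω m ^ 2) P := by
    have := (memLp_id_gaussianReal (μ := 0) (v := Q) 2)
    rw [← (ha m).map_eq] at this
    exact (this.comp_of_map (ha m).aemeasurable).integrable_sq
  simpa [normalizedEnergy] using (integrable_finsetSum _ fun m _ => hsq m).div_const _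

lemma integral_abs_normalizedEnergy_sub_one_le [Nonempty ι] (hQ : Q ≠ 0)
    (ha : ∀ m, HasLaw (fun ω => a ω m) (gaussianReal 0 Q) P)
    (hind : iIndepFun (fun m ω => a ω m) P) :
    ∫ ω, |(normalizedEnergy Q (a ω) : ℝ) - 1| ∂P ≤ √2 / √(Fintype.card ι) := by
  have := hind.isProbabilityMeasure
  have hlaw (m : ι) := hasLaw_div_sqrt hQ (ha m)
  have hsum := integral_abs_sum_le_sqrt
    (hind.comp (fun _ x => (x / √Q) ^ 2 - 1) fun _ => by fun_prop)
    (fun m => (memLp_three_sq_sub_one (hlaw m)).mono_exponent (by norm_num))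
    fun m => integral_sq_sub_one (hlaw m)
  simp only [Function.comp_apply, integral_sq_sub_one_sq (hlaw _), Finset.sum_const,
    Finset.card_univ, nsmul_eq_mul] at hsum
  simp only [normalizedEnergy_sub_one hQ, abs_div, Nat.abs_cast, integral_div]
  refine (div_le_div_of_nonneg_right hsum (Nat.cast_nonneg _)).trans_eq ?_
  rw [Real.sqrt_mul (Nat.cast_nonneg _), mul_comm, mul_div_assoc, Real.sqrt_div_self']
  ring

lemma abs_cdf_gaussianReal_conv_normalizedEnergy_sub_le [Nonempty ι] (hQ : Q ≠ 0)
    (ha : ∀ m, HasLaw (fun ω => a ω m) (gaussianReal 0 Q) P)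
    (hind : iIndepFun (fun m ω => a ω m) P) {μ τ : ℝ≥0} (hτ : τ ≠ 0)
    (hμτ : μ ^ 2 / Fintype.card ι ≤ τ) (x : ℝ) :
    |cdf (gaussianReal 0 τ ∗ P.map fun ω => μ * ((normalizedEnergy Q (a ω) : ℝ) - 1)) x
        - cdf (gaussianReal 0 (τ + 2 * (μ ^ 2 / Fintype.card ι))) x|
      ≤ 11 / √(Fintype.card ι) := by
  set n : ℝ≥0 := (Fintype.card ι : ℝ≥0) with hn
  have hn0 : n ≠ 0 := Nat.cast_ne_zero.2 Fintype.card_ne_zero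
  have hchi := abs_cdf_gaussianReal_conv_sum_sq_sub_one_sub_le
    (hind.comp (fun _ x => x / √Q) fun _ => by fun_prop) (fun m => hasLaw_div_sqrt hQ (ha m))
    (μ / n) hτ x
  have hvar : τ + Fintype.card ι * (2 * (μ / n) ^ 2) = τ + 2 * (μ ^ 2 / n) := by
    rw [← hn]
    field_simp
  have hfun : (fun ω => ((μ / n : ℝ≥0) : ℝ) * ∑ m, ((a ω m / √Q) ^ 2 - 1))
      = fun ω => μ * ((normalizedEnergy Q (a ω) : ℝ) - 1) := by
    ext ω
    rw [normalizedEnergy_sub_one hQ, hn]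
    push_cast
    ring
  have hn' : (0 : ℝ) < Fintype.card ι := Nat.cast_pos.2 Fintype.card_pos
  have hratio : ((μ / n : ℝ≥0) : ℝ) / √τ ≤ 1 / √(Fintype.card ι) := by
    rw [div_le_iff₀ (Real.sqrt_pos.2 (NNReal.coe_pos.2 (pos_iff_ne_zero.2 hτ))), one_div,
      ← Real.sqrt_inv, ← Real.sqrt_mul (inv_nonneg.2 hn'.le)]
    refine Real.le_sqrt_of_sq_le ?_
    have := mul_le_mul_of_nonneg_left (NNReal.coe_le_coe.2 hμτ) (inv_nonneg.2 hn'.le)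
    refine le_trans (le_of_eq ?_) this
    simp only [hn]
    push_cast
    ring
  simp only [Function.comp_apply, hvar, hfun] at hchi
  calc _ ≤ _ := hchi
    _ ≤ 11 * Fintype.card ι * (1 / √(Fintype.card ι)) ^ 3 := by gcongr
    _ = 11 / √(Fintype.card ι) := by
      field_simp
      rw [Real.sq_sqrt hn'.le]

end normalizedEnergy

/-! ### The correlations of One Step Thresholding -/

/-- The part `∑_{j ∈ Λ, j ≠ i} X_j + z` of the received vector that does not come from message `i`.
It is independent of the codeword `X_i`. -/
def interference {n C : ℕ} (Λ : Finset (Fin C)) (i : Fin C) (X : Matrix (Fin n) (Fin C) ℝ)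
    (z : Fin n → ℝ) : Fin n → ℝ :=
  fun m => ∑ j ∈ Λ.erase i, X m j + z m

lemma received_eq_activity_smul_add_interference {n C : ℕ} (Λ : Finset (Fin C)) (i : Fin C)
    (X : Matrix (Fin n) (Fin C) ℝ) (z : Fin n → ℝ) :
    received Λ X z = activity Λ i • X.col i + interference Λ i X z := by
  ext m
  have hsum : (X *ᵥ activity Λ) m = ∑ j ∈ Λ, X m j := by
    simp [Matrix.mulVec, dotProduct, activity]
  by_cases hi : i ∈ Λ
  · rw [← Finset.add_sum_erase _ _ hi] at hsum
    simp only [received, Pi.add_apply, hsum, activity, hi, if_true, Matrix.col_apply, one_smul,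
      interference, add_assoc]
  · simp [received, hsum, interference, activity, hi]

lemma ostCorrelation_eq {n C : ℕ} (Λ : Finset (Fin C)) (i : Fin C) (X : Matrix (Fin n) (Fin C) ℝ)
    (z : Fin n → ℝ) :
    ostCorrelation Λ X z i
      = activity Λ i * ∑ m, X m i ^ 2 + ∑ m, X m i * interference Λ i X z m := by
  rw [ostCorrelation, received_eq_activity_smul_add_interference Λ i, Matrix.mulVec_add,
    Matrix.mulVec_smul]
  simp only [Pi.add_apply, Pi.smul_apply, smul_eq_mul, Matrix.mulVec, dotProduct,
    Matrix.transpose_apply, Matrix.col_apply, sq]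

namespace IsGaussianModel

variable {Ω : Type*} [MeasurableSpace Ω] {P : Measure Ω} {Q : ℝ≥0}
  {n C : ℕ} {X : Ω → Matrix (Fin n) (Fin C) ℝ} {z : Ω → Fin n → ℝ}

lemma hasLaw_entry (hM : IsGaussianModel P Q X z) (p : (Fin n × Fin C) ⊕ Fin n) :
    HasLaw (Sum.elim (fun (p : Fin n × Fin C) ω => X ω p.1 p.2) (fun m ω => z ω m) p)
      (gaussianReal 0 (Sum.elim (fun _ => Q) (fun _ => 1) p)) P := by
  rcases p with p | m
  exacts [hM.codebook_law p.1 p.2, hM.noise_law m]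

lemma iIndepFun_codeword (hM : IsGaussianModel P Q X z) (i : Fin C) :
    iIndepFun (fun m ω => X ω m i) P :=
  hM.indep.precomp (g := fun m => Sum.inl (m, i)) fun m m' h => by simpa using h

lemma aemeasurable_codeword (hM : IsGaussianModel P Q X z) (i : Fin C) :
    AEMeasurable (fun ω m => X ω m i) P :=
  aemeasurable_pi_lambda _ fun m => (hM.codebook_law m i).aemeasurable

lemma aemeasurable_interference (hM : IsGaussianModel P Q X z) (Λ : Finset (Fin C)) (i : Fin C) :
    AEMeasurable (fun ω => interference Λ i (X ω) (z ω)) P :=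
  aemeasurable_pi_lambda _ fun m =>
    (Finset.aemeasurable_fun_sum _ fun j _ => (hM.codebook_law m j).aemeasurable).add
      (hM.noise_law m).aemeasurable

lemma aemeasurable_ostCorrelation (hM : IsGaussianModel P Q X z) (Λ : Finset (Fin C))
    (i : Fin C) : AEMeasurable (fun ω => ostCorrelation Λ (X ω) (z ω) i) P := by
  have hX (m : Fin n) := (hM.codebook_law m i).aemeasurable
  have hw := aemeasurable_pi_iff.1 (hM.aemeasurable_interference Λ i)
  simp only [ostCorrelation_eq]
  fun_prop

lemma aemeasurable_normalizedEnergy (hM : IsGaussianModel P Q X z) (i : Fin C) :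
    AEMeasurable (fun ω => normalizedEnergy Q fun m => X ω m i) P :=
  (measurable_normalizedEnergy Q).comp_aemeasurable (hM.aemeasurable_codeword i)

lemma indepFun_codeword_interference (hM : IsGaussianModel P Q X z) (Λ : Finset (Fin C))
    (i : Fin C) :
    IndepFun (fun ω m => X ω m i) (fun ω => interference Λ i (X ω) (z ω)) P := by
  classical
  let S : Finset ((Fin n × Fin C) ⊕ Fin n) := Finset.univ.image fun m => Sum.inl (m, i)
  have hcodeword (m : Fin n) : Sum.inl (m, i) ∈ S := by simp [S]
  have hother (m : Fin n) (j : Λ.erase i) : Sum.inl (m, j.1) ∈ Sᶜ := by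
    simp [S, (Finset.ne_of_mem_erase j.2).symm]
  have hnoise (m : Fin n) : Sum.inr m ∈ Sᶜ := by simp [S]
  have hblocks := hM.indep.indepFun_finset₀ S Sᶜ disjoint_compl_right
    fun p => (hM.hasLaw_entry p).aemeasurable
  convert! hblocks.comp (φ := fun a m => a ⟨_, hcodeword m⟩)
    (ψ := fun b m => ∑ j ∈ (Λ.erase i).attach, b ⟨_, hother m j⟩ + b ⟨_, hnoise m⟩)
    (by fun_prop) (by fun_prop) using 2 with ω
  ext m
  simp only [interference, Function.comp, Sum.elim_inl, Sum.elim_inr]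
  rw [← Finset.sum_attach]

lemma hasLaw_sum_mul_interference (hM : IsGaussianModel P Q X z) (Λ : Finset (Fin C)) (i : Fin C)
    (c : Fin n → ℝ) :
    HasLaw (fun ω => ∑ m, c m * interference Λ i (X ω) (z ω) m)
      (gaussianReal 0 (((Λ.erase i).card * Q + 1) * ∑ m, ‖c m‖₊ ^ 2)) P := by
  classical
  have hlaw := hasLaw_sum_mul_gaussianReal hM.indep hM.hasLaw_entry
    (Sum.elim (fun p => if p.2 ∈ Λ.erase i then c p.1 else 0) c) Finset.univ
  convert! hlaw using 1
  · ext ω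
    rw [Fintype.sum_sum_type, Fintype.sum_prod_type]
    simp only [Sum.elim_inl, Sum.elim_inr, ite_mul, zero_mul, Finset.sum_ite_mem,
      Finset.univ_inter, interference, mul_add, Finset.sum_add_distrib, Finset.mul_sum]
  · rw [Fintype.sum_sum_type, Fintype.sum_prod_type]
    have hterm (m : Fin n) (j : Fin C) : ‖(if j ∈ Λ.erase i then c m else 0 : ℝ)‖₊ ^ 2 * Q
        = if j ∈ Λ.erase i then ‖c m‖₊ ^ 2 * Q else 0 := by
      split_ifs <;> simp
    simp only [Sum.elim_inl, Sum.elim_inr, hterm, Finset.sum_ite_mem, Finset.univ_inter,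
      Finset.sum_const, mul_one, nsmul_eq_mul, ← Finset.sum_mul, ← Finset.mul_sum]
    congr 1
    ring

lemma map_ostCorrelation (hM : IsGaussianModel P Q X z) (hQ : Q ≠ 0) (Λ : Finset (Fin C))
    (i : Fin C) :
    P.map (fun ω => ostCorrelation Λ (X ω) (z ω) i)
      = gaussianMixture P
          (fun ω => activity Λ i * (n * Q * normalizedEnergy Q fun m => X ω m i))
          fun ω => ((Λ.erase i).card * Q + 1) * (n * Q * normalizedEnergy Q fun m => X ω m i) := by
  have := hM.indep.isProbabilityMeasure
  have hV := measurable_normalizedEnergy (ι := Fin n) Q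
  simp only [ostCorrelation_eq]
  refine map_eq_gaussianMixture_of_indepFun
    (F := fun p => activity Λ i * ∑ m, p.1 m ^ 2 + ∑ m, p.1 m * p.2 m)
    (m := fun c => activity Λ i * (n * Q * normalizedEnergy Q c))
    (v := fun c => ((Λ.erase i).card * Q + 1) * (n * Q * normalizedEnergy Q c))
    (hM.indepFun_codeword_interference Λ i) (hM.aemeasurable_codeword i)
    (hM.aemeasurable_interference Λ i) (by fun_prop) (by fun_prop) (by fun_prop) fun c => ?_
  have henergy := mul_normalizedEnergy hQ c
  rw [Fintype.card_fin] at henergy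
  have hcoe : (n * Q * normalizedEnergy Q c : ℝ) = ∑ m, c m ^ 2 := by
    simpa using congrArg ((↑) : ℝ≥0 → ℝ) henergy
  rw [henergy, hcoe, (gaussianReal_const_add (hM.hasLaw_sum_mul_interference Λ i c)
    (activity Λ i * ∑ m, c m ^ 2)).map_eq, zero_add]

lemma map_ostCorrelation_sub_div (hM : IsGaussianModel P Q X z) (hQ : Q ≠ 0) (Λ : Finset (Fin C))
    (i : Fin C) (b d : ℝ) {μ : ℝ} (hμ : activity Λ i * (n * Q) / d = μ) {τ : ℝ≥0}
    (hτ : ((Λ.erase i).card * Q + 1) * (n * Q) / d ^ 2 = (τ : ℝ)) :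
    P.map (fun ω => (ostCorrelation Λ (X ω) (z ω) i - b) / d)
      = gaussianMixture P (fun ω => μ * (normalizedEnergy Q fun m => X ω m i) - b / d)
          fun ω => τ * normalizedEnergy Q fun m => X ω m i := by
  have := hM.indep.isProbabilityMeasure
  have hV := hM.aemeasurable_normalizedEnergy i
  have hcomp : (fun ω => (ostCorrelation Λ (X ω) (z ω) i - b) / d)
      = (fun y => (y - b) / d) ∘ fun ω => ostCorrelation Λ (X ω) (z ω) i := rfl
  rw [hcomp, ← AEMeasurable.map_map_of_aemeasurable (by fun_prop)
    (hM.aemeasurable_ostCorrelation Λ i), hM.map_ostCorrelation hQ,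
    map_sub_div_gaussianMixture (by fun_prop) (by fun_prop)]
  congr 1 <;> ext ω
  · rw [← hμ]
    ring
  · push_cast
    rw [← hτ, Real.norm_eq_abs, sq_abs]
    ring

lemma abs_cdf_map_ostCorrelation_sub_div_sub_le (hM : IsGaussianModel P Q X z) (hQ : Q ≠ 0)
    (hn : n ≠ 0) (Λ : Finset (Fin C)) (i : Fin C) (b d : ℝ) {μ : ℝ}
    (hμ : activity Λ i * (n * Q) / d = μ) {τ : ℝ≥0} (hτ0 : τ ≠ 0)
    (hτ : ((Λ.erase i).card * Q + 1) * (n * Q) / d ^ 2 = (τ : ℝ)) (x : ℝ) :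
    |cdf (P.map fun ω => (ostCorrelation Λ (X ω) (z ω) i - b) / d) x
        - cdf (gaussianReal 0 τ
            ∗ P.map fun ω => μ * (normalizedEnergy Q fun m => X ω m i) - b / d) x|
      ≤ 3 / 2 * (√2 / √n) := by
  have := hM.indep.isProbabilityMeasure
  have := NeZero.mk hn
  have hV := hM.aemeasurable_normalizedEnergy i
  have hmean : AEMeasurable
      (fun ω => μ * ((normalizedEnergy Q fun m => X ω m i : ℝ≥0) : ℝ) - b / d) P := by fun_prop
  have hdev := integral_abs_normalizedEnergy_sub_one_le hQ (fun m => hM.codebook_law m i)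
    (hM.iIndepFun_codeword i)
  rw [Fintype.card_fin] at hdev
  rw [hM.map_ostCorrelation_sub_div hQ Λ i b d hμ hτ, ← gaussianMixture_const hmean]
  exact (abs_cdf_gaussianMixture_sub_le hmean
    (integrable_normalizedEnergy fun m => hM.codebook_law m i) hτ0 x).trans (by gcongr)

end IsGaussianModel

lemma sq_mul_sqrt_add_inv_div {Q : ℝ≥0} (hQ : Q ≠ 0) {n : ℕ} (hn : n ≠ 0) {k : ℝ} (hk : 0 ≤ k) :
    ((n : ℝ) * (Q : ℝ) * √((k + 1 / (Q : ℝ)) / (n : ℝ))) ^ 2 = (k * Q + 1) * (n * Q) := by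
  rw [mul_pow, Real.sq_sqrt (by positivity)]
  field_simp

lemma div_sqrt_le_div_pi_mul_sqrt {c c' : ℝ} (h : c * Real.pi ≤ c') (n : ℝ) :
    c / √n ≤ c' / (Real.pi * √n) := by
  rw [← div_div]
  gcongr
  rwa [le_div_iff₀ Real.pi_pos]

namespace IsGaussianModel

variable {Ω : Type*} [MeasurableSpace Ω] {P : Measure Ω} {Q : ℝ≥0}
  {n C : ℕ} {X : Ω → Matrix (Fin n) (Fin C) ℝ} {z : Ω → Fin n → ℝ}

lemma abs_cdf_ostCorrelation_sub_le_of_notMem (hM : IsGaussianModel P Q X z) (hQ : Q ≠ 0)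
    (hn : n ≠ 0) {Λ : Finset (Fin C)} {i : Fin C} (hi : i ∉ Λ) (x : ℝ) :
    |cdf (P.map fun ω => ostCorrelation Λ (X ω) (z ω) i /
        ((n : ℝ) * (Q : ℝ) * √(((Λ.card : ℝ) + 1 / (Q : ℝ)) / (n : ℝ)))) x
      - cdf (gaussianReal 0 1) x| ≤ 8 / (Real.pi * √(n : ℝ)) := by
  have := hM.indep.isProbabilityMeasure
  set d := (n : ℝ) * (Q : ℝ) * √(((Λ.card : ℝ) + 1 / (Q : ℝ)) / (n : ℝ)) with hd
  have hd2 : d ^ 2 = (Λ.card * Q + 1) * (n * Q) :=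
    sq_mul_sqrt_add_inv_div hQ hn (Nat.cast_nonneg _)
  have hvar : ((Λ.erase i).card * Q + 1) * (n * Q) / d ^ 2 = ((1 : ℝ≥0) : ℝ) := by
    rw [Finset.erase_eq_of_notMem hi, hd2, NNReal.coe_one]
    exact div_self (by positivity)
  have hfreeze := hM.abs_cdf_map_ostCorrelation_sub_div_sub_le hQ hn Λ i 0 d (μ := 0)
    (by simp [activity, hi]) one_ne_zero hvar x
  simp only [sub_zero, zero_mul, zero_div, Measure.map_const, measure_univ, one_smul,
    Measure.conv_dirac_zero] at hfreeze
  refine hfreeze.trans ?_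
  rw [← mul_div_assoc]
  exact div_sqrt_le_div_pi_mul_sqrt
    (by nlinarith [Real.pi_lt_d2, Real.pi_pos, Real.sqrt_two_lt_three_halves]) _

lemma abs_cdf_map_ostCorrelation_sub_div_sub_cdf_gaussianReal_le (hM : IsGaussianModel P Q X z)
    (hQ : Q ≠ 0) (hn : n ≠ 0) {Λ : Finset (Fin C)} {i : Fin C} (hi : i ∈ Λ) {d : ℝ} {μ τ : ℝ≥0}
    (hμ : (μ : ℝ) = n * Q / d) (hτ0 : τ ≠ 0)
    (hτ : ((Λ.erase i).card * Q + 1) * (n * Q) / d ^ 2 = (τ : ℝ)) (hμτ : μ ^ 2 / n ≤ τ) (x : ℝ) :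
    |cdf (P.map fun ω => (ostCorrelation Λ (X ω) (z ω) i - n * Q) / d) x
        - cdf (gaussianReal 0 (τ + 2 * (μ ^ 2 / n))) x|
      ≤ (3 / 2 * √2 + 11) / √n := by
  have := NeZero.mk hn
  have hfreeze := hM.abs_cdf_map_ostCorrelation_sub_div_sub_le hQ hn Λ i (n * Q) d (μ := μ)
    (by simp [activity, hi, hμ]) hτ0 hτ x
  have hlindeberg := abs_cdf_gaussianReal_conv_normalizedEnergy_sub_le hQ
    (fun m => hM.codebook_law m i) (hM.iIndepFun_codeword i) (μ := μ) hτ0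
    (by rwa [Fintype.card_fin]) x
  have hmean (ω : Ω) : μ * (normalizedEnergy Q fun m => X ω m i) - n * Q / d
      = μ * ((normalizedEnergy Q fun m => X ω m i : ℝ) - 1) := by
    rw [hμ]
    ring
  rw [Fintype.card_fin] at hlindeberg
  simp only [hmean] at hfreeze
  refine ((abs_sub_le _ _ _).trans (add_le_add hfreeze hlindeberg)).trans_eq ?_
  ring

lemma abs_cdf_ostCorrelation_sub_le_of_mem (hM : IsGaussianModel P Q X z) (hQ : Q ≠ 0)
    (hn : n ≠ 0) {Λ : Finset (Fin C)} {i : Fin C} (hi : i ∈ Λ) (hΛ : 2 ≤ Λ.card) (x : ℝ) :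
    |cdf (P.map fun ω => (ostCorrelation Λ (X ω) (z ω) i - (n : ℝ) * (Q : ℝ)) /
        ((n : ℝ) * (Q : ℝ) * √(((Λ.card : ℝ) + 1 + 1 / (Q : ℝ)) / (n : ℝ)))) x
      - cdf (gaussianReal 0 1) x| ≤ 64 / (Real.pi * √(n : ℝ)) := by
  obtain ⟨k, hk⟩ : ∃ k, (Λ.erase i).card = k + 1 :=
    Nat.exists_eq_add_one.2 (by rw [Finset.card_erase_of_mem hi]; omega)
  have hcard : (Λ.card : ℝ) = k + 2 := by
    rw [← Finset.card_erase_add_one hi, hk]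
    push_cast
    ring
  set d := (n : ℝ) * (Q : ℝ) * √(((Λ.card : ℝ) + 1 + 1 / (Q : ℝ)) / (n : ℝ))
  have hd2 : d ^ 2 = ((k + 3) * Q + 1) * (n * Q) := by
    rw [sq_mul_sqrt_add_inv_div hQ hn (by positivity), hcard]
    ring
  obtain ⟨μ, hμ⟩ : ∃ μ : ℝ≥0, (μ : ℝ) = n * Q / d := ⟨⟨_, by positivity⟩, rfl⟩
  have hμ2 : μ ^ 2 / n = Q / ((k + 3) * Q + 1) := by
    ext
    push_cast
    rw [hμ, div_pow, hd2]
    field_simp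
  have hvar : ((k + 1) * Q + 1) / ((k + 3) * Q + 1) + 2 * (μ ^ 2 / n) = 1 := by
    rw [hμ2]
    field_simp
    ring
  have hμτ : μ ^ 2 / n ≤ ((k + 1) * Q + 1) / ((k + 3) * Q + 1) := by
    rw [hμ2, add_one_mul (k : ℝ≥0), add_assoc]
    gcongr
    exact le_add_left le_self_add
  have hbound := hM.abs_cdf_map_ostCorrelation_sub_div_sub_cdf_gaussianReal_le hQ hn hi hμ
    (by positivity) (by rw [hd2, hk]; push_cast; field_simp) hμτ x
  rw [hvar] at hbound
  exact hbound.trans (div_sqrt_le_div_pi_mul_sqrt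
    (by nlinarith [Real.pi_lt_d2, Real.pi_pos, Real.sqrt_two_lt_three_halves]) _)

end IsGaussianModel

lemma tendstoInDistribution_ostCorrelation {Q : ℝ≥0} (hQ : Q ≠ 0) {Ω : ℕ → Type*}
    [∀ r, MeasurableSpace (Ω r)] (P : ∀ r, Measure (Ω r)) [∀ r, IsProbabilityMeasure (P r)]
    {n C : ℕ → ℕ} {ε : ℝ} {ρ : ℝ≥0} {Λ : ∀ r, Finset (Fin (C r))}
    {X : ∀ r, Ω r → Matrix (Fin (n r)) (Fin (C r)) ℝ} {z : ∀ r, Ω r → Fin (n r) → ℝ}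
    (hM : ∀ r, IsGaussianModel (P r) Q (X r) (z r)) (hn : Tendsto n atTop atTop)
    (i : ∀ r, Fin (C r)) (hε : ∀ r, activity (Λ r) (i r) = ε)
    (hρ : Tendsto (fun r => ((((Λ r).erase (i r)).card : ℝ) + 1 / (Q : ℝ)) / (n r : ℝ)) atTop
      (𝓝 (ρ : ℝ))) :
    TendstoInDistribution
      (fun r ω => ostCorrelation (Λ r) (X r ω) (z r ω) (i r) / ((n r : ℝ) * (Q : ℝ)))
      atTop id P (gaussianReal ε ρ) := by
  have hQ' : (Q : ℝ) ≠ 0 := NNReal.coe_ne_zero.2 hQ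
  refine tendstoInDistribution_of_map_eq_gaussianMixture
    (V := fun r ω => normalizedEnergy Q fun m => X r ω m (i r))
    (v := fun r => (((Λ r).erase (i r)).card + 1 / Q) / n r)
    (fun r => ((hM r).aemeasurable_ostCorrelation (Λ r) (i r)).div_const _)
    (fun r => integrable_normalizedEnergy fun m => (hM r).codebook_law m (i r)) ?_ ?_
    (by push_cast; exact hρ)
  · filter_upwards [hn.eventually_ne_atTop 0] with r hr
    have hr' : (n r : ℝ) ≠ 0 := Nat.cast_ne_zero.2 hr
    simpa using (hM r).map_ostCorrelation_sub_div hQ (Λ r) (i r) 0 (n r * Q) (μ := ε)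
      (τ := (((Λ r).erase (i r)).card + 1 / Q) / n r)
      (by rw [hε r]; field_simp) (by push_cast; field_simp)
  · have hrate : Tendsto (fun r => √2 / √(n r : ℝ)) atTop (𝓝 0) :=
      tendsto_const_nhds.div_atTop
        (Real.tendsto_sqrt_atTop.comp (tendsto_natCast_atTop_atTop.comp hn))
    refine squeeze_zero' (Eventually.of_forall fun r => by positivity) ?_ hrate
    filter_upwards [hn.eventually_ne_atTop 0] with r hr
    have := NeZero.mk hr
    simpa using integral_abs_normalizedEnergy_sub_one_le hQ
      (fun m => (hM r).codebook_law m (i r)) ((hM r).iIndepFun_codeword (i r))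

theorem theorem1_general (Q : ℝ≥0) (hQ : 0 < Q) :
    (∀ {Ω : ℕ → Type*} [∀ r, MeasurableSpace (Ω r)] (P : ∀ r, Measure (Ω r))
        [∀ r, IsProbabilityMeasure (P r)] (n C : ℕ → ℕ) (ρ : ℝ≥0)
        (Λ : ∀ r, Finset (Fin (C r)))
        (X : ∀ r, Ω r → Matrix (Fin (n r)) (Fin (C r)) ℝ) (z : ∀ r, Ω r → Fin (n r) → ℝ),
      (∀ r, IsGaussianModel (P r) Q (X r) (z r)) →
      Tendsto n atTop atTop →
      Tendsto (fun r => (((Λ r).card : ℝ) + 1 / (Q : ℝ)) / (n r : ℝ)) atTop (𝓝 (ρ : ℝ)) →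
      ∀ i : ∀ r, Fin (C r),
        ((∀ r, i r ∈ Λ r) →
          TendstoInDistribution
            (fun r ω => ostCorrelation (Λ r) (X r ω) (z r ω) (i r) / ((n r : ℝ) * (Q : ℝ)))
            atTop id P (gaussianReal 1 ρ)) ∧
        ((∀ r, i r ∉ Λ r) →
          TendstoInDistribution
            (fun r ω => ostCorrelation (Λ r) (X r ω) (z r ω) (i r) / ((n r : ℝ) * (Q : ℝ)))
            atTop id P (gaussianReal 0 ρ))) ∧
    (∀ {Ω : Type*} [MeasurableSpace Ω] (P : Measure Ω) (n C : ℕ)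
        (Λ : Finset (Fin C)) (X : Ω → Matrix (Fin n) (Fin C) ℝ) (z : Ω → Fin n → ℝ),
      IsGaussianModel P Q X z →
      1 ≤ n →
      ∀ i : Fin C,
        (i ∉ Λ → ∀ x : ℝ,
          |cdf (P.map fun ω => ostCorrelation Λ (X ω) (z ω) i /
              ((n : ℝ) * (Q : ℝ) * √(((Λ.card : ℝ) + 1 / (Q : ℝ)) / (n : ℝ)))) x
            - cdf (gaussianReal 0 1) x| ≤ 8 / (Real.pi * √(n : ℝ))) ∧
        (i ∈ Λ → 2 ≤ Λ.card → ∀ x : ℝ,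
          |cdf (P.map fun ω => (ostCorrelation Λ (X ω) (z ω) i - (n : ℝ) * (Q : ℝ)) /
              ((n : ℝ) * (Q : ℝ) * √(((Λ.card : ℝ) + 1 + 1 / (Q : ℝ)) / (n : ℝ)))) x
            - cdf (gaussianReal 0 1) x| ≤ 64 / (Real.pi * √(n : ℝ)))) := by
  refine ⟨fun P _ n C ρ Λ X z hM hn hρ i => ⟨fun hi => ?_, fun hi => ?_⟩,
    fun P n C Λ X z hM hn i => ⟨fun hi x => ?_, fun hi hΛ x => ?_⟩⟩
  · refine tendstoInDistribution_ostCorrelation hQ.ne' P hM hn i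
      (fun r => by simp [activity, hi r]) ?_
    have hone : Tendsto (fun r => 1 / (n r : ℝ)) atTop (𝓝 0) :=
      tendsto_const_nhds.div_atTop (tendsto_natCast_atTop_atTop.comp hn)
    refine (sub_zero (ρ : ℝ) ▸ hρ.sub hone).congr fun r => ?_
    rw [← Finset.card_erase_add_one (hi r)]
    push_cast
    ring
  · exact tendstoInDistribution_ostCorrelation hQ.ne' P hM hn i
      (fun r => by simp [activity, hi r])
      (by simpa only [Finset.erase_eq_of_notMem (hi _)] using hρ)
  · exact hM.abs_cdf_ostCorrelation_sub_le_of_notMem hQ.ne' (by omega) hi x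
  · exact hM.abs_cdf_ostCorrelation_sub_le_of_mem hQ.ne' (by omega) hi hΛ x

theorem theorem1 (Q : ℝ≥0) (hQ : 0 < Q) :
    -- convergence in distribution of the normalized correlations
    (∀ {Ω : ℕ → Type*} [∀ r, MeasurableSpace (Ω r)] (P : ∀ r, Measure (Ω r))
        [∀ r, IsProbabilityMeasure (P r)] (K n C : ℕ → ℕ) (δ : ℝ) (ρ : ℝ≥0)
        (Λ : ∀ r, Finset (Fin (C r)))
        (X : ∀ r, Ω r → Matrix (Fin (n r)) (Fin (C r)) ℝ) (z : ∀ r, Ω r → Fin (n r) → ℝ),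
      (∀ r, (Λ r).card = K r) →
      (∀ r, IsGaussianModel (P r) Q (X r) (z r)) →
      Tendsto n atTop atTop →
      Tendsto (fun r => (K r : ℝ) / (C r : ℝ)) atTop (𝓝 δ) →
      Tendsto (fun r => ((K r : ℝ) + 1 / (Q : ℝ)) / (n r : ℝ)) atTop (𝓝 (ρ : ℝ)) →
      ∀ i : ∀ r, Fin (C r),
        ((∀ r, i r ∈ Λ r) →
          TendstoInDistribution
            (fun r ω => ostCorrelation (Λ r) (X r ω) (z r ω) (i r) / ((n r : ℝ) * (Q : ℝ)))
            atTop id P (gaussianReal 1 ρ)) ∧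
        ((∀ r, i r ∉ Λ r) →
          TendstoInDistribution
            (fun r ω => ostCorrelation (Λ r) (X r ω) (z r ω) (i r) / ((n r : ℝ) * (Q : ℝ)))
            atTop id P (gaussianReal 0 ρ))) ∧
    -- explicit bounds for a single problem
    (∀ {Ω : Type*} [MeasurableSpace Ω] (P : Measure Ω) [IsProbabilityMeasure P] (K n C : ℕ)
        (Λ : Finset (Fin C)) (X : Ω → Matrix (Fin n) (Fin C) ℝ) (z : Ω → Fin n → ℝ),
      Λ.card = K →
      IsGaussianModel P Q X z →
      ∀ i : Fin C,
        (i ∉ Λ → 1 ≤ n → ∀ x : ℝ,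
          |cdf (P.map fun ω => ostCorrelation Λ (X ω) (z ω) i /
              ((n : ℝ) * (Q : ℝ) * √(((K : ℝ) + 1 / (Q : ℝ)) / (n : ℝ)))) x
            - cdf (gaussianReal 0 1) x| ≤ 8 / (Real.pi * √(n : ℝ))) ∧
        (i ∈ Λ → 2 ≤ K → 12 ≤ n → ∀ x : ℝ,
          |cdf (P.map fun ω => (ostCorrelation Λ (X ω) (z ω) i - (n : ℝ) * (Q : ℝ)) /
              ((n : ℝ) * (Q : ℝ) * √(((K : ℝ) + 1 + 1 / (Q : ℝ)) / (n : ℝ)))) x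
            - cdf (gaussianReal 0 1) x| ≤ 64 / (Real.pi * √(n : ℝ)))) := by
  obtain ⟨hlimit, hbound⟩ := theorem1_general Q hQ
  refine ⟨fun P _ K n C _ ρ Λ X z hK hM hn _ hρ => ?_, fun P _ K n C Λ X z hK hM i => ?_⟩
  · obtain rfl : (fun r => (Λ r).card) = K := funext hK
    exact hlimit P n C ρ Λ X z hM hn hρ
  · subst hK
    exact ⟨fun hi hn => (hbound P n C Λ X z hM hn i).1 hi,
      fun hi hΛ hn => (hbound P n C Λ X z hM (by omega) i).2 hi hΛ⟩
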